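/- There is an absolute constant $c>0$ and, for every integer $n\ge 1$, a constant $c_n>0$ depending only on $n$ such that the following holds. A rectangle is a set $\prod_{i=1}^n[a_i,b_i]\subset\mathbb{R}^n$ with $a_i<b_i$ for all $i$, $|\cdot|$ is Lebesgue measure, and a weight is a non-negative locally integrable function $w$ on $\mathbb{R}^n$, with $w(E)=\int_E w$. For $1<p<\infty$ put $$[w]_{A_p^{\mathsf{rec}}}=\sup_R\Big(\frac1{|R|}\int_R w\Big)\Big(\frac1{|R|}\int_R w^{-\frac1{p-1}}\Big)^{p-1},\qquad [w]_{A_1^{\mathsf{rec}}}=\sup_R\Big(\frac1{|R|}\int_R w\Big)\operatorname*{ess\,sup}_R\,(w^{-1}),$$ the suprema being taken over all rectangles $R$ (a negative power of $0$ is $\infty$, and $0\cdot\infty=0$), and write $w\in A_p^*$ if $[w]_{A_p^{\mathsf{rec}}}<\infty$. Let $p\in[1,\infty)$, $w\in A_p^*$, $0<\delta<e^{-cn[w]_{A_p^{\mathsf{rec}}}}$, and let $R_1,\dots,R_N$ be a finite list of rectangles in $\mathbb{R}^n$. Let $\tilde R_1,\dots,\tilde R_M$ be its Córdoba–Fefferman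 selection with parameter $\delta$: going through the list in order, $R_j$ is selected if and only if the part of $R_j$ covered by the rectangles selected before it has measure at most $(1-\delta)|R_j|$. Then (i) $\displaystyle w\Big(\bigcup_{j}R_j\Big)\le\Big(1+c_n\,\delta^{\,1/(cn[w]_{A_p^{\mathsf{rec}}})}\Big)\,w\Big(\bigcup_k\tilde R_k\Big)$; (ii) $\displaystyle \sum_k w(\tilde R_k)\le\frac{[w]_{A_p^{\mathsf{rec}}}}{\delta^{p}}\;w\Big(\bigcup_k\tilde R_k\Big)$. (If $w=0$ a.e., all terms vanish and the value of the exponent in (i) is immaterial.) -/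

import Mathlib

open MeasureTheory
open scoped ENNReal

noncomputable section

/-- A weight on `ℝⁿ`: a non-negative, locally integrable function. -/
structure IsWeight {n : ℕ} (w : (Fin n → ℝ) → ℝ) : Prop where
  nonneg : ∀ x, 0 ≤ w x
  locallyIntegrable : LocallyIntegrable w volume

/-- The closed axis-parallel rectangle `∏ᵢ [aᵢ, bᵢ]` (with `aᵢ < bᵢ` for all `i`). -/
def rectangle {n : ℕ} (R : BoxIntegral.Box (Fin n)) : Set (Fin n → ℝ) :=
  Set.Icc R.lower R.upper

/-- `w(E) = ∫_E w`. -/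
def weightOf {n : ℕ} (w : (Fin n → ℝ) → ℝ) (E : Set (Fin n → ℝ)) : ℝ :=
  ∫ x in E, w x

/-- The dual factor of the `A_p` condition on the set `E`: it is
`(|E|⁻¹ ∫_E w ^ (-1/(p-1))) ^ (p-1)` for `p ≠ 1` and `ess sup_E w⁻¹` for `p = 1`.
The powers are taken in `[0,∞]`, so that a negative power of `0` is `∞`. -/
def dualFactor {n : ℕ} (p : ℝ) (w : (Fin n → ℝ) → ℝ) (E : Set (Fin n → ℝ)) : ℝ≥0∞ :=
  if p = 1 then
    essSup (fun x => (ENNReal.ofReal (w x))⁻¹) (volume.restrict E)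
  else
    ((volume E)⁻¹ * ∫⁻ x in E, (ENNReal.ofReal (w x)) ^ (-(1 / (p - 1)))) ^ (p - 1)

/-- The rectangular constant `[w]_{A_p^rec} ∈ [0,∞]`, a supremum over all axis-parallel
rectangles. -/
def apRec {n : ℕ} (p : ℝ) (w : (Fin n → ℝ) → ℝ) : ℝ≥0∞ :=
  ⨆ R : BoxIntegral.Box (Fin n),
    ((volume (rectangle R))⁻¹ * ∫⁻ x in rectangle R, ENNReal.ofReal (w x)) *
      dualFactor p w (rectangle R)

/-- `w` is a strong (multiparameter) Muckenhoupt weight of class `A_p^*`. -/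
def MemApStar {n : ℕ} (p : ℝ) (w : (Fin n → ℝ) → ℝ) : Prop :=
  IsWeight w ∧ apRec p w < ∞

/-- `S` is the set of indices that the Córdoba–Fefferman selection with parameter `δ` picks from
the list `R`: going through the list in its order, a rectangle is picked exactly when at most the
proportion `1 - δ` of it is covered by the rectangles picked before it. -/
def IsCordobaFeffermanSelection {n N : ℕ} (δ : ℝ) (R : Fin N → BoxIntegral.Box (Fin n))
    (S : Finset (Fin N)) : Prop :=
  ∀ j, j ∈ S ↔
    volume (rectangle (R j) ∩ ⋃ i ∈ {i | i ∈ S ∧ i < j}, rectangle (R i)) ≤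
      ENNReal.ofReal (1 - δ) * volume (rectangle (R j))

end

/-!
By Hölder's inequality the `A_p` condition implies the condition `|R| w(R) ≤ K (∫_R √w)²` with
`K = [w]_{A_p^rec}`, in which `p` no longer appears. In dimension one, a Bellman function of the
means of `w` and `√w` turns it into `w(F) ≤ 9 (|F| / |I|) ^ (1 / (64 K)) w(I)` for subsets `F` of an
interval `I`. Since intervals have subcovers of overlap at most two, the intervals that are almost
covered by a set `S` then add little weight to `S`.

The rectangles of the list are unions of cells of a finite grid. A rectangle that is not selected is
covered by the selected ones up to the proportion `δ = η ^ n`, so it is reached from them by passing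
`n` times, one coordinate after the other, to the union of the segments covered up to the proportion
`η`. Each passage is the one-dimensional estimate for the cylinders over a fixed cell in the other
coordinates; these inherit the condition on `w` because they are themselves rectangles. Working
with cylinders instead of lines avoids slicing `w` almost everywhere.

For (ii), the parts `E_k` of the selected rectangles not covered before are disjoint with
`|E_k| ≥ δ |R_k|`, and Hölder's inequality gives `w(R_k) ≤ K δ ^ (-p) w(E_k)`.
-/

/-! ### The Bellman function -/

section Bellman

/-- The Bellman function of the reverse Hölder inequality, in the variables `x = ⟨w⟩` and
`y = ⟨√w⟩`. It is comparable to `x ^ (1 + e / 2)` on the domain `y ² ≤ x ≤ K y ²`, and midpoint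
concave there when `e` is a small multiple of `1 / K`. -/
noncomputable def bellman (K e x y : ℝ) : ℝ :=
  y ^ (2 + e) * (4 * (x / y ^ 2) - 2 - (x / y ^ 2) ^ 2 / K ^ 2)

variable {K e r : ℝ}

theorem mul_abs_rpow_sub_one_le (he0 : 0 ≤ e) (he1 : e ≤ 1) (hr0 : 0 ≤ r) (hr2 : r ≤ 2) :
    r * |r ^ e - 1| ≤ 2 * e * r ^ (e / 2) * |r - 1| := by
  have bernoulli {s : ℝ} (hs : 0 ≤ s) : s ^ e - 1 ≤ e * (s - 1) := by
    have := rpow_one_add_le_one_add_mul_self (s := s - 1) (by linarith) he0 he1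
    rw [add_sub_cancel] at this
    linarith
  rcases hr0.eq_or_lt with rfl | hr
  · rw [zero_mul]; positivity
  rcases le_total 1 r with h1 | h1
  · have hpow : 1 ≤ r ^ (e / 2) := Real.one_le_rpow h1 (by positivity)
    rw [abs_of_nonneg (sub_nonneg.2 (Real.one_le_rpow h1 he0)), abs_of_nonneg (sub_nonneg.2 h1)]
    calc r * (r ^ e - 1) ≤ 2 * (e * (r - 1)) :=
          mul_le_mul hr2 (bernoulli hr0) (sub_nonneg.2 (Real.one_le_rpow h1 he0)) two_pos.le
      _ = 2 * e * 1 * (r - 1) := by ring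
      _ ≤ 2 * e * r ^ (e / 2) * (r - 1) := by gcongr
  · have hpow : r ^ e ≤ r ^ (e / 2) := Real.rpow_le_rpow_of_exponent_ge hr h1 (by linarith)
    rw [abs_of_nonpos (sub_nonpos.2 (Real.rpow_le_one hr0 h1 he0)),
      abs_of_nonpos (sub_nonpos.2 h1)]
    calc r * -(r ^ e - 1) = r * r ^ e * (r⁻¹ ^ e - 1) := by
          rw [Real.inv_rpow hr0]
          field_simp
          ring
      _ ≤ r * r ^ e * (e * (r⁻¹ - 1)) := by gcongr; exact bernoulli (by positivity)
      _ = 1 * e * r ^ e * -(r - 1) := by field_simp; ring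
      _ ≤ 2 * e * r ^ (e / 2) * -(r - 1) := by gcongr <;> linarith

theorem rpow_two_add_le (he0 : 0 ≤ e) (he1 : e ≤ 1) (hr0 : 0 ≤ r) (hr2 : r ≤ 2) :
    r ^ (2 + e) ≤ 1 + (2 + e) * (r - 1) + (1 + 3 * e) * (r - 1) ^ 2 := by
  have bernoulli : r ^ e ≤ 1 + e * (r - 1) := by
    simpa using rpow_one_add_le_one_add_mul_self (s := r - 1) (by linarith) he0 he1
  calc r ^ (2 + e) = r ^ 2 * r ^ e := by
        rw [Real.rpow_add_of_nonneg hr0 two_pos.le he0, Real.rpow_two]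
    _ ≤ r ^ 2 * (1 + e * (r - 1)) := by gcongr
    _ = 1 + (2 + e) * (r - 1) + (r - 1) ^ 2 + e * (r + 1) * (r - 1) ^ 2 := by ring
    _ ≤ 1 + (2 + e) * (r - 1) + (r - 1) ^ 2 + e * 3 * (r - 1) ^ 2 := by gcongr; linarith
    _ = _ := by ring

theorem mul_rpow_two_add_le {h : ℝ} (he0 : 0 ≤ e) (he1 : e ≤ 1) (hr0 : 0 ≤ r) (hr2 : r ≤ 2)
    (h0 : 0 ≤ h) (heh : 4 * e * h ≤ 1) :
    h * r ^ (2 + e) ≤ h * (1 + (2 + e) * (r - 1)) + (h + 3 / 4) * (r - 1) ^ 2 := by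
  nlinarith [mul_le_mul_of_nonneg_left (rpow_two_add_le he0 he1 hr0 hr2) h0,
    mul_le_mul_of_nonneg_right heh (sq_nonneg (r - 1))]

theorem mul_rpow_sub_one_le_add_sq {s d : ℝ} (hK : 1 ≤ K) (he0 : 0 ≤ e) (heK : 16 * K * e ≤ 1)
    (hr0 : 0 ≤ r) (hr2 : r ≤ 2) (hs : |s| ≤ 4) :
    s * d * (r ^ 2 * (r ^ e - 1)) ≤ d ^ 2 * r ^ (2 + e) / K ^ 2 + (r - 1) ^ 2 / 16 := by
  have he1 : e ≤ 1 := by nlinarith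
  have hpow : r ^ (2 + e) = (r * r ^ (e / 2)) ^ 2 := by
    rw [Real.rpow_add_of_nonneg hr0 two_pos.le he0, Real.rpow_two, mul_pow,
      ← Real.rpow_mul_natCast hr0, Nat.cast_ofNat, div_mul_cancel₀ e two_ne_zero]
  have heK' : (4 * e * K) ^ 2 ≤ 1 / 16 := by
    nlinarith [mul_nonneg he0 (zero_le_one.trans hK)]
  set a := |d| * (r * r ^ (e / 2)) with ha
  calc s * d * (r ^ 2 * (r ^ e - 1))
      ≤ |s * d * (r ^ 2 * (r ^ e - 1))| := le_abs_self _
    _ = |s| * (|d| * r) * (r * |r ^ e - 1|) := by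
        simp only [abs_mul, abs_pow, abs_of_nonneg hr0]; ring
    _ ≤ 4 * (|d| * r) * (2 * e * r ^ (e / 2) * |r - 1|) := by
        exact mul_le_mul (by gcongr) (mul_abs_rpow_sub_one_le he0 he1 hr0 hr2)
          (by positivity) (by positivity)
    _ = 2 * (a / K) * (4 * e * K * |r - 1|) := by rw [ha]; field_simp
    _ ≤ (a / K) ^ 2 + (4 * e * K * |r - 1|) ^ 2 := two_mul_le_add_sq _ _
    _ = d ^ 2 * r ^ (2 + e) / K ^ 2 + (4 * e * K) ^ 2 * (r - 1) ^ 2 := by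
        rw [ha, hpow, div_pow, mul_pow |d|, sq_abs, mul_pow (4 * e * K), sq_abs]
    _ ≤ _ := by linarith [mul_le_mul_of_nonneg_right heK' (sq_nonneg (r - 1))]

/-- The right-hand side is the tangent plane of the Bellman function at `(X, 1)`, evaluated at
`(v * r ^ 2, r)`. -/
theorem rpow_mul_le_tangent {X : ℝ} (hX1 : 1 ≤ X) (hXK : X ≤ K) (he0 : 0 ≤ e)
    (heK : 16 * K * e ≤ 1) (hr0 : 0 ≤ r) (hr2 : r ≤ 2) (v : ℝ) :
    r ^ (2 + e) * (4 * v - 2 - v ^ 2 / K ^ 2) ≤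
      (4 * X - 2 - X ^ 2 / K ^ 2) + (4 - 2 * X / K ^ 2) * (v * r ^ 2 - X) +
        ((2 + e) * (4 * X - 2 - X ^ 2 / K ^ 2) - 2 * X * (4 - 2 * X / K ^ 2)) * (r - 1) := by
  have hK : 1 ≤ K := hX1.trans hXK
  have he1 : e ≤ 1 := by nlinarith
  have hXK1 : X / K ^ 2 ≤ 1 := div_le_one_of_le₀ (by nlinarith) (by positivity)
  have hXK2 : X ^ 2 / K ^ 2 ≤ 1 := div_le_one_of_le₀ (by gcongr) (by positivity)
  have hXK1' : 0 ≤ X / K ^ 2 := by positivity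
  have hXK2' : 0 ≤ X ^ 2 / K ^ 2 := by positivity
  set h := 4 * X - 2 - X ^ 2 / K ^ 2 with hh
  set h' := 4 - 2 * X / K ^ 2 with hh'
  have hradial := mul_rpow_two_add_le (h := h) he0 he1 hr0 hr2 (by linarith) (by nlinarith)
  have hcross := mul_rpow_sub_one_le_add_sq (s := h') (d := v - X) hK he0 heK hr0 hr2
    (abs_le.2 ⟨by rw [hh', mul_div_assoc]; linarith, by rw [hh', mul_div_assoc]; linarith⟩)
  have hcurvature : 0 ≤ (h' * X - (h + 1)) * (r - 1) ^ 2 := by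
    have : h' * X - (h + 1) = 1 - X ^ 2 / K ^ 2 := by rw [hh, hh']; ring
    rw [this]
    exact mul_nonneg (by linarith) (sq_nonneg _)
  have hpow : r ^ (2 + e) = r ^ 2 * r ^ e := by
    rw [Real.rpow_add_of_nonneg hr0 two_pos.le he0, Real.rpow_two]
  have hexpand : r ^ (2 + e) * (4 * v - 2 - v ^ 2 / K ^ 2) = h * r ^ (2 + e) +
      h' * (v - X) * r ^ (2 + e) - (v - X) ^ 2 * r ^ (2 + e) / K ^ 2 := by
    rw [hh, hh']; ring
  rw [hpow] at hradial hcross hexpand ⊢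
  nlinarith [sq_nonneg (r - 1)]

theorem bellman_le_tangent {X Y x y : ℝ} (hY : 0 < Y) (hYX : Y ^ 2 ≤ X) (hXY : X ≤ K * Y ^ 2)
    (he0 : 0 ≤ e) (heK : 16 * K * e ≤ 1) (hx : 0 ≤ x) (hxy : x ≤ K * y ^ 2) (hy : 0 ≤ y)
    (hyY : y ≤ 2 * Y) :
    bellman K e x y ≤ bellman K e X Y +
      Y ^ (2 + e) * ((4 - 2 * (X / Y ^ 2) / K ^ 2) * ((x - X) / Y ^ 2)) +
      Y ^ (2 + e) * (((2 + e) * (4 * (X / Y ^ 2) - 2 - (X / Y ^ 2) ^ 2 / K ^ 2) -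
        2 * (X / Y ^ 2) * (4 - 2 * (X / Y ^ 2) / K ^ 2)) * ((y - Y) / Y)) := by
  have hx' : x / y ^ 2 * (y / Y) ^ 2 = x / Y ^ 2 := by
    rcases hy.eq_or_lt with rfl | hy
    · have : x = 0 := le_antisymm (by simpa using hxy) hx
      simp [this]
    · field_simp
  have htangent := rpow_mul_le_tangent (r := y / Y) ((one_le_div₀ (by positivity)).2 hYX)
    ((div_le_iff₀ (by positivity)).2 hXY) he0 heK (by positivity) ((div_le_iff₀ hY).2 hyY)
    (x / y ^ 2)
  rw [hx', ← sub_div, div_sub_one hY.ne'] at htangent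
  calc bellman K e x y
      = Y ^ (2 + e) * ((y / Y) ^ (2 + e) * (4 * (x / y ^ 2) - 2 - (x / y ^ 2) ^ 2 / K ^ 2)) := by
        rw [bellman, ← mul_assoc, ← Real.mul_rpow hY.le (by positivity), mul_div_cancel₀ y hY.ne']
    _ ≤ Y ^ (2 + e) * _ := mul_le_mul_of_nonneg_left htangent (by positivity)
    _ = _ := by rw [bellman]; ring

theorem bellman_zero_right (he0 : 0 ≤ e) (x : ℝ) : bellman K e x 0 = 0 := by
  rw [bellman, Real.zero_rpow (by positivity), zero_mul]

theorem bellman_add_le_two_mul_midpoint {x₁ x₂ y₁ y₂ : ℝ} (he0 : 0 ≤ e) (heK : 16 * K * e ≤ 1)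
    (hx₁ : 0 ≤ x₁) (hx₂ : 0 ≤ x₂) (hy₁ : 0 ≤ y₁) (hy₂ : 0 ≤ y₂) (h₁ : x₁ ≤ K * y₁ ^ 2)
    (h₂ : x₂ ≤ K * y₂ ^ 2) (hYX : ((y₁ + y₂) / 2) ^ 2 ≤ (x₁ + x₂) / 2)
    (hXY : (x₁ + x₂) / 2 ≤ K * ((y₁ + y₂) / 2) ^ 2) :
    bellman K e x₁ y₁ + bellman K e x₂ y₂ ≤ 2 * bellman K e ((x₁ + x₂) / 2) ((y₁ + y₂) / 2) := by
  rcases (add_nonneg hy₁ hy₂).eq_or_lt with hY | hY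
  · obtain ⟨rfl, rfl⟩ := (add_eq_zero_iff_of_nonneg hy₁ hy₂).1 hY.symm
    simp [bellman_zero_right he0]
  · have t₁ := bellman_le_tangent (half_pos hY) hYX hXY he0 heK hx₁ h₁ hy₁ (by linarith)
    have t₂ := bellman_le_tangent (half_pos hY) hYX hXY he0 heK hx₂ h₂ hy₂ (by linarith)
    refine (add_le_add t₁ t₂).trans_eq ?_
    ring

section Bounds

variable {x y : ℝ} (he0 : 0 ≤ e) (hx : 0 ≤ x) (hy : 0 ≤ y) (hyx : y ^ 2 ≤ x) (hxy : x ≤ K * y ^ 2)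
include he0 hy hxy hx hyx

theorem bellman_le_four_mul : bellman K e x y ≤ 4 * x * x ^ (e / 2) := by
  rcases hy.eq_or_lt with rfl | hy
  · rw [bellman_zero_right he0]; positivity
  have hpow : y ^ e ≤ x ^ (e / 2) := by
    calc y ^ e = (y ^ 2) ^ (e / 2) := by
          rw [← Real.rpow_natCast_mul hy.le, Nat.cast_ofNat, mul_div_cancel₀ e two_ne_zero]
      _ ≤ x ^ (e / 2) := by gcongr
  calc bellman K e x y ≤ y ^ (2 + e) * (4 * (x / y ^ 2)) := by
        rw [bellman]
        gcongr
        have : 0 ≤ (x / y ^ 2) ^ 2 / K ^ 2 := by positivity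
        linarith
    _ = 4 * x * y ^ e := by rw [Real.rpow_add hy, Real.rpow_two]; field_simp
    _ ≤ 4 * x * x ^ (e / 2) := by gcongr

theorem mul_rpow_le_bellman (hK : 1 ≤ K) : x * y ^ e ≤ bellman K e x y := by
  rcases hy.eq_or_lt with rfl | hy
  · have : x = 0 := le_antisymm (by simpa using hxy) hx
    simp [bellman_zero_right he0, this]
  have h1 : 1 ≤ x / y ^ 2 := (one_le_div₀ (by positivity)).2 hyx
  have hle : x / y ^ 2 ≤ K := (div_le_iff₀ (by positivity)).2 hxy
  have hsq : (x / y ^ 2) ^ 2 / K ^ 2 ≤ 1 := div_le_one_of_le₀ (by gcongr) (by positivity)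
  calc x * y ^ e = y ^ (2 + e) * (x / y ^ 2) := by
        rw [Real.rpow_add hy, Real.rpow_two]; field_simp
    _ ≤ bellman K e x y := by
        rw [bellman]
        gcongr
        linarith

theorem bellman_nonneg (hK : 1 ≤ K) : 0 ≤ bellman K e x y :=
  (by positivity : 0 ≤ x * y ^ e).trans (mul_rpow_le_bellman he0 hx hy hyx hxy hK)

theorem mul_rpow_le_two_mul_bellman (hK : 1 ≤ K) (heK : 16 * K * e ≤ 1) :
    x * x ^ (e / 2) ≤ 2 * bellman K e x y := by
  have hKpow : K ^ (e / 2) ≤ 2 := by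
    have := rpow_one_add_le_one_add_mul_self (s := K - 1) (p := e / 2) (by linarith)
      (by positivity) (by nlinarith)
    rw [add_sub_cancel] at this
    nlinarith
  calc x * x ^ (e / 2) ≤ x * (K * y ^ 2) ^ (e / 2) := by gcongr
    _ = x * (K ^ (e / 2) * y ^ e) := by
        rw [Real.mul_rpow (by positivity) (by positivity), ← Real.rpow_natCast_mul hy,
          Nat.cast_ofNat, mul_div_cancel₀ e two_ne_zero]
    _ ≤ x * (2 * y ^ e) := by gcongr
    _ = 2 * (x * y ^ e) := by ring
    _ ≤ _ := by gcongr; exact mul_rpow_le_bellman he0 hx hy hyx hxy hK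

end Bounds

end Bellman

/-! ### The one-dimensional estimate -/

/-- The measures `ω` and `σ`, which stand for `w dx` and `√w dx`, satisfy Cauchy–Schwarz
`σ(A i)² ≤ |A i| ω(A i)` on all sets of the family `A`, and its reversal with constant `K`. -/
structure SqrtComparable {ι X : Type*} [MeasureSpace X] (A : ι → Set X) (K : ℝ)
    (ω σ : Measure X) : Prop where
  ne_top : ∀ i, ω (A i) ≠ ∞
  sqrt_ne_top : ∀ i, σ (A i) ≠ ∞
  sq_le : ∀ i, σ.real (A i) ^ 2 ≤ volume.real (A i) * ω.real (A i)
  mul_le : ∀ i, volume.real (A i) * ω.real (A i) ≤ K * σ.real (A i) ^ 2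

theorem SqrtComparable.one_le {ι X : Type*} [MeasureSpace X] {A : ι → Set X} {K : ℝ}
    {ω σ : Measure X} (h : SqrtComparable A K ω σ) {i : ι}
    (hi : 0 < volume.real (A i) * ω.real (A i)) : 1 ≤ K := by
  have hσ := hi.trans_le (h.mul_le i)
  have hK : 0 < K := pos_of_mul_pos_left hσ (sq_nonneg _)
  exact (le_mul_iff_one_le_left hi).1 ((h.mul_le i).trans (by gcongr; exact h.sq_le i))

/-- The half-open interval with the given pair of endpoints, as an index family for
`SqrtComparable`. -/
abbrev interval (I : ℝ × ℝ) : Set ℝ := Set.Ioc I.1 I.2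

/-- The mean of `ω` over `(s, t]`. -/
noncomputable def mean (ω : Measure ℝ) (s t : ℝ) : ℝ := ω.real (Set.Ioc s t) / (t - s)

theorem nonpos_of_le_add_midpoint {f : ℝ → ℝ → ℝ}
    (hf : ∀ s t, s < t → f s t ≤ f s ((s + t) / 2) + f ((s + t) / 2) t) {ρ : ℝ} (hρ : 0 < ρ)
    (hsmall : ∀ s t, s < t → t - s ≤ ρ → f s t ≤ 0) {s t : ℝ} (hst : s < t) : f s t ≤ 0 := by
  obtain ⟨k, hk⟩ : ∃ k : ℕ, t - s ≤ ρ * 2 ^ k := by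
    obtain ⟨k, hk⟩ := pow_unbounded_of_one_lt ((t - s) / ρ) one_lt_two
    exact ⟨k, by rw [div_lt_iff₀' hρ] at hk; exact hk.le⟩
  induction k generalizing s t with
  | zero => exact hsmall s t hst (by simpa using hk)
  | succ k ih =>
    rw [pow_succ] at hk
    have hleft := ih (s := s) (t := (s + t) / 2) (by linarith) (by linarith)
    have hright := ih (s := (s + t) / 2) (t := t) (by linarith) (by linarith)
    linarith [hf s t hst]

theorem measureReal_inter_Ioc_add_inter_Ioc {μ : Measure ℝ} {s m t : ℝ} (hsm : s ≤ m) (hmt : m ≤ t)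
    (hμ : μ (Set.Ioc s t) ≠ ∞) (A : Set ℝ) :
    μ.real (A ∩ Set.Ioc s m) + μ.real (A ∩ Set.Ioc m t) = μ.real (A ∩ Set.Ioc s t) := by
  have hdiff : Set.Ioc s t \ Set.Ioc s m = Set.Ioc m t := by
    ext x
    simp only [Set.mem_sdiff, Set.mem_Ioc]
    grind
  rw [← measureReal_inter_add_sdiff (s := A ∩ Set.Ioc s t) (measurableSet_Ioc (a := s) (b := m))
    (measure_ne_top_of_subset Set.inter_subset_right hμ), Set.inter_assoc, Set.inter_sdiff_assoc,
    Set.inter_eq_self_of_subset_right (Set.Ioc_subset_Ioc_right hmt), hdiff]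

theorem mean_nonneg (ω : Measure ℝ) {s t : ℝ} (hst : s < t) : 0 ≤ mean ω s t :=
  div_nonneg measureReal_nonneg (sub_pos.2 hst).le

theorem mean_mul_length (ω : Measure ℝ) {s t : ℝ} (hst : s < t) :
    mean ω s t * (t - s) = ω.real (Set.Ioc s t) :=
  div_mul_cancel₀ _ (sub_pos.2 hst).ne'

theorem mean_eq_midpoint {ω : Measure ℝ} {s t : ℝ} (hst : s < t) (hω : ω (Set.Ioc s t) ≠ ∞) :
    mean ω s t = (mean ω s ((s + t) / 2) + mean ω ((s + t) / 2) t) / 2 := by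
  have hsplit := measureReal_inter_Ioc_add_inter_Ioc (s := s) (m := (s + t) / 2) (t := t)
    (by linarith) (by linarith) hω Set.univ
  simp only [Set.univ_inter] at hsplit
  have : t - s ≠ 0 := (sub_pos.2 hst).ne'
  rw [mean, mean, mean, ← hsplit, show (s + t) / 2 - s = (t - s) / 2 by ring,
    show t - (s + t) / 2 = (t - s) / 2 by ring]
  field_simp

namespace SqrtComparable

variable {ω σ : Measure ℝ} {K : ℝ}

theorem mean_sq_le (h : SqrtComparable interval K ω σ) {s t : ℝ} (hst : s < t) :
    mean σ s t ^ 2 ≤ mean ω s t := by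
  have := h.sq_le (s, t)
  have hpos := sub_pos.2 hst
  rw [Real.volume_real_Ioc_of_le hst.le] at this
  rw [mean, mean, div_pow, div_le_div_iff₀ (by positivity) hpos]
  nlinarith

theorem mean_le (h : SqrtComparable interval K ω σ) {s t : ℝ} (hst : s < t) :
    mean ω s t ≤ K * mean σ s t ^ 2 := by
  have := h.mul_le (s, t)
  have hpos := sub_pos.2 hst
  rw [Real.volume_real_Ioc_of_le hst.le] at this
  rw [mean, mean, div_pow, mul_div_assoc', div_le_div_iff₀ hpos (by positivity)]
  nlinarith

variable {e : ℝ}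

theorem mean_le_mul_bellman (h : SqrtComparable interval K ω σ) (hK : 1 ≤ K) (he0 : 0 ≤ e)
    (heK : 16 * K * e ≤ 1) {L s t : ℝ} (hst : s < t) (hL : 0 < L) (hLω : L ≤ mean ω s t) :
    mean ω s t ≤ 2 * L ^ (-(e / 2)) * bellman K e (mean ω s t) (mean σ s t) := by
  have hnonneg := mean_nonneg ω hst
  have hpow : L ^ (e / 2) * mean ω s t ≤ 2 * bellman K e (mean ω s t) (mean σ s t) := by
    calc L ^ (e / 2) * mean ω s t ≤ mean ω s t ^ (e / 2) * mean ω s t := by gcongr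
      _ = mean ω s t * mean ω s t ^ (e / 2) := mul_comm _ _
      _ ≤ _ := mul_rpow_le_two_mul_bellman he0 hnonneg (mean_nonneg σ hst)
        (h.mean_sq_le hst) (h.mean_le hst) hK heK
  rw [Real.rpow_neg hL.le, mul_right_comm, ← div_eq_mul_inv, le_div_iff₀' (by positivity)]
  exact hpow

theorem bellman_mean_nonneg (h : SqrtComparable interval K ω σ) (hK : 1 ≤ K) (he0 : 0 ≤ e)
    {s t : ℝ} (hst : s < t) : 0 ≤ bellman K e (mean ω s t) (mean σ s t) :=
  bellman_nonneg he0 (mean_nonneg ω hst) (mean_nonneg σ hst) (h.mean_sq_le hst) (h.mean_le hst) hK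

theorem bellman_mean_add_le (h : SqrtComparable interval K ω σ) (he0 : 0 ≤ e)
    (heK : 16 * K * e ≤ 1) {s t : ℝ} (hst : s < t) :
    bellman K e (mean ω s ((s + t) / 2)) (mean σ s ((s + t) / 2)) +
      bellman K e (mean ω ((s + t) / 2) t) (mean σ ((s + t) / 2) t) ≤
        2 * bellman K e (mean ω s t) (mean σ s t) := by
  have hsm : s < (s + t) / 2 := by linarith
  have hmt : (s + t) / 2 < t := by linarith
  have hsq := h.mean_sq_le hst
  have hle := h.mean_le hst
  rw [mean_eq_midpoint hst (h.ne_top (s, t)),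
    mean_eq_midpoint hst (h.sqrt_ne_top (s, t))] at hsq hle ⊢
  exact bellman_add_le_two_mul_midpoint he0 heK (mean_nonneg ω hsm) (mean_nonneg ω hmt)
    (mean_nonneg σ hsm) (mean_nonneg σ hmt) (h.mean_le hsm) (h.mean_le hmt) hsq hle

theorem measureReal_Ioc_le_add_bellman (h : SqrtComparable interval K ω σ) (hK : 1 ≤ K)
    (he0 : 0 ≤ e) (heK : 16 * K * e ≤ 1) {L s t : ℝ} (hst : s < t) (hL : 0 < L) :
    ω.real (Set.Ioc s t) ≤ L * (t - s) +
      2 * L ^ (-(e / 2)) * ((t - s) * bellman K e (mean ω s t) (mean σ s t)) := by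
  have hpos := sub_pos.2 hst
  have hbellman := h.bellman_mean_nonneg hK he0 hst
  rw [← mean_mul_length ω hst]
  rcases le_total (mean ω s t) L with hle | hle
  · have : mean ω s t * (t - s) ≤ L * (t - s) := by gcongr
    have : 0 ≤ 2 * L ^ (-(e / 2)) * ((t - s) * bellman K e (mean ω s t) (mean σ s t)) := by
      positivity
    linarith
  · have := mul_le_mul_of_nonneg_right (h.mean_le_mul_bellman hK he0 heK hst hL hle) hpos.le
    have : 0 ≤ L * (t - s) := by positivity
    linarith

theorem measureReal_inter_le_add_bellman (h : SqrtComparable interval K ω σ) (hK : 1 ≤ K)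
    (he0 : 0 ≤ e) (heK : 16 * K * e ≤ 1) {F G : Set ℝ} {ρ : ℝ} (hρ : 0 < ρ)
    (hFG : ∀ s t, t - s ≤ ρ → (F ∩ Set.Ioc s t).Nonempty → Set.Ioc s t ⊆ G) {L : ℝ} (hL : 0 < L)
    {s t : ℝ} (hst : s < t) :
    ω.real (F ∩ Set.Ioc s t) ≤ L * volume.real (G ∩ Set.Ioc s t) +
      2 * L ^ (-(e / 2)) * ((t - s) * bellman K e (mean ω s t) (mean σ s t)) := by
  rw [← sub_nonpos]
  refine nonpos_of_le_add_midpoint (f := fun s t => ω.real (F ∩ Set.Ioc s t) -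
    (L * volume.real (G ∩ Set.Ioc s t) +
      2 * L ^ (-(e / 2)) * ((t - s) * bellman K e (mean ω s t) (mean σ s t))))
    (fun s t hst => ?_) hρ (fun s t hst hsmall => sub_nonpos.2 ?_) hst
  · have hconcave := mul_le_mul_of_nonneg_left (h.bellman_mean_add_le he0 heK hst)
      (mul_nonneg (by positivity : 0 ≤ L ^ (-(e / 2))) (sub_pos.2 hst).le)
    rw [← measureReal_inter_Ioc_add_inter_Ioc (by linarith) (by linarith : (s + t) / 2 ≤ t)
      (h.ne_top (s, t)) F, ← measureReal_inter_Ioc_add_inter_Ioc (by linarith)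
      (by linarith : (s + t) / 2 ≤ t) measure_Ioc_lt_top.ne G]
    linarith
  · rcases (F ∩ Set.Ioc s t).eq_empty_or_nonempty with hF | hF
    · have := h.bellman_mean_nonneg hK he0 hst
      have := sub_pos.2 hst
      rw [hF, measureReal_empty]
      positivity
    · rw [Set.inter_eq_self_of_subset_right (hFG s t hsmall hF), Real.volume_real_Ioc_of_le hst.le]
      exact (measureReal_mono Set.inter_subset_right (h.ne_top (s, t))).trans
        (h.measureReal_Ioc_le_add_bellman hK he0 heK hst hL)

theorem measureReal_inter_le_add_bellman_of_isCompact (h : SqrtComparable interval K ω σ)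
    (hK : 1 ≤ K) (he0 : 0 ≤ e) (heK : 16 * K * e ≤ 1) {F : Set ℝ} (hF : IsCompact F)
    {c L s t : ℝ} (hL : 0 < L) (hst : s < t) (hFc : volume F < ENNReal.ofReal c) :
    ω.real (F ∩ Set.Ioc s t) ≤
      L * c + 2 * L ^ (-(e / 2)) * ((t - s) * bellman K e (mean ω s t) (mean σ s t)) := by
  obtain ⟨ρ, hρc, hρ : 0 < ρ⟩ := (((tendsto_measure_cthickening_of_isCompact hF).eventually_lt_const
    hFc).filter_mono nhdsWithin_le_nhds |>.and (self_mem_nhdsWithin (s := Set.Ioi 0))).exists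
  have hthick : volume.real (Metric.cthickening ρ F ∩ Set.Ioc s t) ≤ c :=
    ENNReal.toReal_le_of_le_ofReal (ENNReal.ofReal_pos.1 (bot_lt_of_lt hFc)).le
      ((measure_mono Set.inter_subset_left).trans hρc.le)
  have hshort (a b : ℝ) (hab : b - a ≤ ρ) (hne : (F ∩ Set.Ioc a b).Nonempty) :
      Set.Ioc a b ⊆ Metric.cthickening ρ F := by
    obtain ⟨x, hxF, hx⟩ := hne
    exact fun y hy => Metric.mem_cthickening_of_dist_le y x ρ F hxF ((Real.dist_le_of_mem_Icc
      (Set.Ioc_subset_Icc_self hy) (Set.Ioc_subset_Icc_self hx)).trans hab)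
  refine (h.measureReal_inter_le_add_bellman hK he0 heK hρ hshort hL hst).trans ?_
  gcongr

theorem measureReal_inter_le_of_isCompact (h : SqrtComparable interval K ω σ) (hK : 1 ≤ K)
    {F : Set ℝ} (hF : IsCompact F) {η s t : ℝ} (hη : 0 < η) (hη1 : η ≤ 1) (hst : s < t)
    (hFη : volume F < ENNReal.ofReal (η * (t - s))) :
    ω.real (F ∩ Set.Ioc s t) ≤ 9 * η ^ (1 / (64 * K)) * ω.real (Set.Ioc s t) := by
  rcases (mean_nonneg ω hst).eq_or_lt with hx | hx
  · have hzero : ω.real (Set.Ioc s t) = 0 := by rw [← mean_mul_length ω hst, ← hx, zero_mul]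
    rw [hzero, mul_zero, ← hzero]
    exact measureReal_mono Set.inter_subset_right (h.ne_top (s, t))
  have := sub_pos.2 hst
  set x := mean ω s t
  set L := x * η ^ (-1 / 2 : ℝ)
  have hpow : L ^ (-(1 / (16 * K) / 2)) * x ^ (1 / (16 * K) / 2) = η ^ (1 / (64 * K)) := by
    rw [Real.mul_rpow hx.le (by positivity), mul_right_comm, ← Real.rpow_add hx, neg_add_cancel,
      Real.rpow_zero, one_mul, ← Real.rpow_mul hη.le]
    congr 1
    ring
  have hroot : η ^ (-1 / 2 : ℝ) * η ≤ η ^ (1 / (64 * K)) := by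
    rw [← Real.rpow_add_one hη.ne']
    refine Real.rpow_le_rpow_of_exponent_ge hη hη1 ?_
    rw [div_le_iff₀ (by positivity)]
    linarith
  calc ω.real (F ∩ Set.Ioc s t)
      ≤ L * (η * (t - s)) + 2 * L ^ (-(1 / (16 * K) / 2)) *
          ((t - s) * bellman K (1 / (16 * K)) x (mean σ s t)) :=
        h.measureReal_inter_le_add_bellman_of_isCompact hK (by positivity) (by field_simp; rfl)
          hF (by positivity) hst hFη
    _ ≤ L * (η * (t - s)) + 2 * L ^ (-(1 / (16 * K) / 2)) *
          ((t - s) * (4 * x * x ^ (1 / (16 * K) / 2))) := by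
        gcongr
        exact bellman_le_four_mul (by positivity) hx.le (mean_nonneg σ hst) (h.mean_sq_le hst)
          (h.mean_le hst)
    _ = (η ^ (-1 / 2 : ℝ) * η) * (x * (t - s)) + 8 * η ^ (1 / (64 * K)) * (x * (t - s)) := by
        rw [← hpow]; ring
    _ ≤ η ^ (1 / (64 * K)) * (x * (t - s)) + 8 * η ^ (1 / (64 * K)) * (x * (t - s)) := by gcongr
    _ = 9 * η ^ (1 / (64 * K)) * ω.real (Set.Ioc s t) := by rw [mean_mul_length ω hst]; ring

theorem measureReal_le_of_subset_Ioc (h : SqrtComparable interval K ω σ) (hK : 1 ≤ K)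
    {F : Set ℝ} (hF : MeasurableSet F) {η s t : ℝ} (hη : 0 < η) (hη1 : η ≤ 1) (hst : s < t)
    (hFst : F ⊆ Set.Ioc s t) (hFη : volume F < ENNReal.ofReal (η * (t - s))) :
    ω.real F ≤ 9 * η ^ (1 / (64 * K)) * ω.real (Set.Ioc s t) := by
  have : IsFiniteMeasure (ω.restrict (Set.Ioc s t)) :=
    isFiniteMeasure_restrict.2 (h.ne_top (s, t))
  have hFω : (ω.restrict (Set.Ioc s t)) F = ω F := Measure.restrict_eq_self ω hFst
  refine ENNReal.toReal_le_of_le_ofReal (by positivity) ?_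
  rw [← hFω, hF.measure_eq_iSup_isCompact_of_ne_top (measure_ne_top _ F)]
  refine iSup₂_le fun C hCF => iSup_le fun hC => ?_
  rw [Measure.restrict_apply hC.measurableSet, ← ofReal_measureReal
    (measure_ne_top_of_subset Set.inter_subset_right (h.ne_top (s, t)))]
  exact ENNReal.ofReal_le_ofReal
    (h.measureReal_inter_le_of_isCompact hK hC hη hη1 hst ((measure_mono hCF).trans_lt hFη))

end SqrtComparable

/-! ### Discrete Solyanik estimates -/

section Discrete

/-- The union of the order intervals of which less than the proportion `η` lies outside of `S`, with
sizes measured by `v`. -/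
noncomputable def densityHull {β : Type*} [Fintype β] [DecidableEq β] [Preorder β]
    [LocallyFiniteOrder β] (v : β → ℝ) (η : ℝ) (S : Finset β) : Finset β :=
  ({I | ∑ t ∈ Finset.Icc I.1 I.2 \ S, v t < η * ∑ t ∈ Finset.Icc I.1 I.2, v t} :
    Finset (β × β)).biUnion fun I => Finset.Icc I.1 I.2

theorem mem_densityHull {β : Type*} [Fintype β] [DecidableEq β] [Preorder β] [LocallyFiniteOrder β]
    {v : β → ℝ} {η : ℝ} {S : Finset β} {x : β} : x ∈ densityHull v η S ↔ ∃ a b,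
      x ∈ Finset.Icc a b ∧ ∑ t ∈ Finset.Icc a b \ S, v t < η * ∑ t ∈ Finset.Icc a b, v t := by
  simp only [densityHull, Finset.mem_biUnion, Finset.mem_filter_univ, Prod.exists, and_comm]

theorem densityHull_one_subset {β : Type*} [Fintype β] [DecidableEq β] [Preorder β]
    [LocallyFiniteOrder β] [Subsingleton β] (v : β → ℝ) (S : Finset β) :
    densityHull v 1 S ⊆ S := by
  intro x hx
  obtain ⟨a, b, -, hlt⟩ := mem_densityHull.1 hx
  by_contra hxS
  rw [Finset.sdiff_eq_self_of_disjoint, one_mul] at hlt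
  · exact lt_irrefl _ hlt
  · exact Finset.disjoint_left.2 fun y _ hy => hxS (Subsingleton.elim x y ▸ hy)

theorem sum_eq_sum_sum_cons {α : Type*} {n : ℕ} {C : Finset (Fin (n + 1) → α)}
    {Q : Finset (Fin n → α)} {I : (Fin n → α) → Finset α}
    (h : ∀ t z, Fin.cons t z ∈ C ↔ z ∈ Q ∧ t ∈ I z) (f : (Fin (n + 1) → α) → ℝ) :
    ∑ x ∈ C, f x = ∑ z ∈ Q, ∑ t ∈ I z, f (Fin.cons t z) := by
  rw [← Finset.sum_finset_product_right' (C.map (Fin.consEquiv fun _ => α).symm.toEmbedding) Q I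
    (f := fun t z => f (Fin.cons t z)), Finset.sum_map]
  · simp
  · rintro ⟨t, z⟩
    rw [← h, Finset.mem_map_equiv]
    rfl

variable {α : Type*} [LinearOrder α] [LocallyFiniteOrder α]

theorem exists_biUnion_erase_Icc_eq {T : Finset (α × α)} {t : α}
    (ht : 2 < (T.filter fun J => t ∈ Finset.Icc J.1 J.2).card) :
    ∃ C ∈ T, (T.erase C).biUnion (fun J => Finset.Icc J.1 J.2) =
      T.biUnion fun J => Finset.Icc J.1 J.2 := by
  set U := T.filter fun J => t ∈ Finset.Icc J.1 J.2
  have hU : U.Nonempty := Finset.card_pos.1 (by omega)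
  obtain ⟨A, hA, hAmin⟩ := U.exists_min_image Prod.fst hU
  obtain ⟨B, hB, hBmax⟩ := U.exists_max_image Prod.snd hU
  obtain ⟨C, hC, hCAB⟩ := Finset.exists_mem_notMem_of_card_lt_card
    (Finset.card_le_two.trans_lt ht : ({A, B} : Finset (α × α)).card < U.card)
  have hCA := hAmin C hC
  have hCB := hBmax C hC
  simp only [Finset.mem_insert, Finset.mem_singleton, not_or] at hCAB
  simp only [U, Finset.mem_filter, Finset.mem_Icc] at hA hB hC
  refine ⟨C, hC.1, (Finset.biUnion_subset_biUnion_of_subset_left _ (T.erase_subset C)).antisymm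
    fun s hs => ?_⟩
  simp only [Finset.mem_biUnion, Finset.mem_erase, Finset.mem_Icc] at hs ⊢
  obtain ⟨J, hJ, hsJ⟩ := hs
  by_cases hJC : J = C
  · subst hJC
    rcases le_total s t with hst | hst
    · exact ⟨A, ⟨Ne.symm hCAB.1, hA.1⟩, hCA.trans hsJ.1, hst.trans hA.2.2⟩
    · exact ⟨B, ⟨Ne.symm hCAB.2, hB.1⟩, hB.2.1.trans hst, hsJ.2.trans hCB⟩
  · exact ⟨J, ⟨hJC, hJ⟩, hsJ⟩

theorem exists_subcover_card_filter_mem_Icc_le_two (T : Finset (α × α)) :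
    ∃ T' ⊆ T, T'.biUnion (fun J => Finset.Icc J.1 J.2) = T.biUnion (fun J => Finset.Icc J.1 J.2) ∧
      ∀ t, (T'.filter fun J => t ∈ Finset.Icc J.1 J.2).card ≤ 2 := by
  induction T using Finset.strongInduction with
  | H T ih =>
    by_cases h : ∀ t, (T.filter fun J => t ∈ Finset.Icc J.1 J.2).card ≤ 2
    · exact ⟨T, subset_rfl, rfl, h⟩
    · push Not at h
      obtain ⟨t, ht⟩ := h
      obtain ⟨C, hC, hCT⟩ := exists_biUnion_erase_Icc_eq ht
      obtain ⟨T', hT', hunion, hcard⟩ := ih _ (Finset.erase_ssubset hC)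
      exact ⟨T', hT'.trans (T.erase_subset C), hunion.trans hCT, hcard⟩

/-- A discrete `A_∞` condition: the sum of `u` over a part of an interval is small when that part
has small `v`-size. -/
def LineAInfty (v u : α → ℝ) (η ε : ℝ) : Prop :=
  ∀ a b : α, ∀ F ⊆ Finset.Icc a b, ∑ t ∈ F, v t < η * ∑ t ∈ Finset.Icc a b, v t →
    ∑ t ∈ F, u t ≤ ε * ∑ t ∈ Finset.Icc a b, u t

variable [Fintype α] {v u : α → ℝ} {η ε : ℝ}

theorem sum_densityHull_sdiff_le (hu : ∀ t, 0 ≤ u t) (hε : 0 ≤ ε) (h : LineAInfty v u η ε)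
    (S : Finset α) :
    ∑ t ∈ densityHull v η S \ S, u t ≤ 2 * ε * ∑ t ∈ densityHull v η S, u t := by
  obtain ⟨T, hT, hcover, hcard⟩ := exists_subcover_card_filter_mem_Icc_le_two
    {I : α × α | ∑ t ∈ Finset.Icc I.1 I.2 \ S, v t < η * ∑ t ∈ Finset.Icc I.1 I.2, v t}
  have hmem (t : α) : t ∈ densityHull v η S ↔ ∃ I ∈ T, t ∈ Finset.Icc I.1 I.2 := by
    rw [densityHull, ← hcover, Finset.mem_biUnion]
  calc ∑ t ∈ densityHull v η S \ S, u t
      ≤ ∑ t ∈ densityHull v η S \ S, ∑ I ∈ T with t ∈ Finset.Icc I.1 I.2, u t := by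
        refine Finset.sum_le_sum fun t ht => ?_
        obtain ⟨I, hI, htI⟩ := (hmem t).1 (Finset.mem_sdiff.1 ht).1
        exact Finset.single_le_sum (f := fun _ => u t) (fun _ _ => hu t)
          (Finset.mem_filter.2 ⟨hI, htI⟩)
    _ = ∑ I ∈ T, ∑ t ∈ Finset.Icc I.1 I.2 \ S, u t := by
        refine Finset.sum_comm' fun t I => ?_
        simp only [Finset.mem_sdiff, Finset.mem_filter, hmem]
        grind
    _ ≤ ∑ I ∈ T, ε * ∑ t ∈ Finset.Icc I.1 I.2, u t := Finset.sum_le_sum fun I hI =>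
        h _ _ _ Finset.sdiff_subset (Finset.mem_filter.1 (hT hI)).2
    _ = ε * ∑ t ∈ densityHull v η S, ∑ I ∈ T with t ∈ Finset.Icc I.1 I.2, u t := by
        rw [← Finset.mul_sum]
        congr 1
        refine Finset.sum_comm' fun I t => ?_
        simp only [Finset.mem_filter, hmem]
        grind
    _ ≤ ε * ∑ t ∈ densityHull v η S, 2 * u t := by
        gcongr with t
        rw [Finset.sum_const, nsmul_eq_mul]
        exact mul_le_mul_of_nonneg_right (by exact_mod_cast hcard t) (hu t)
    _ = 2 * ε * ∑ t ∈ densityHull v η S, u t := by rw [← Finset.mul_sum]; ring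

theorem sum_densityHull_le_of_lineAInfty (hu : ∀ t, 0 ≤ u t) (hε : 0 ≤ ε) (hε4 : 4 * ε ≤ 1)
    (h : LineAInfty v u η ε) (S : Finset α) :
    ∑ t ∈ densityHull v η S, u t ≤ (1 + 4 * ε) * ∑ t ∈ S, u t := by
  have hsdiff := sum_densityHull_sdiff_le hu hε h S
  have hinter : ∑ t ∈ densityHull v η S ∩ S, u t ≤ ∑ t ∈ S, u t :=
    Finset.sum_le_sum_of_subset_of_nonneg Finset.inter_subset_right fun t _ _ => hu t
  have hsplit := Finset.sum_inter_add_sum_sdiff (densityHull v η S) S u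
  have hnonneg : 0 ≤ ∑ t ∈ densityHull v η S, u t := Finset.sum_nonneg fun t _ => hu t
  have habsorb : (1 - 2 * ε) * ∑ t ∈ densityHull v η S, u t ≤ ∑ t ∈ S, u t := by linarith
  calc ∑ t ∈ densityHull v η S, u t
      ≤ (1 + 4 * ε) * (1 - 2 * ε) * ∑ t ∈ densityHull v η S, u t :=
        le_mul_of_one_le_left hnonneg (by nlinarith)
    _ = (1 + 4 * ε) * ((1 - 2 * ε) * ∑ t ∈ densityHull v η S, u t) := by ring
    _ ≤ (1 + 4 * ε) * ∑ t ∈ S, u t := by gcongr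

section Slices

variable {n : ℕ}

theorem mem_densityHull_of_cons_mem (hv : ∀ t, 0 < v t) (hη : 0 < η)
    {E : Finset (Fin (n + 1) → α)} {s : α} {y : Fin n → α}
    (hy : Fin.cons s y ∈ densityHull (fun y => ∏ i, v (y i)) (η ^ (n + 1)) E) :
    y ∈ densityHull (fun y => ∏ i, v (y i)) (η ^ n)
      {z | s ∈ densityHull v η {t | (Fin.cons t z : Fin (n + 1) → α) ∈ E}} := by
  obtain ⟨a, b, hab, hlt⟩ := mem_densityHull.1 hy
  rw [Finset.mem_Icc, Fin.le_cons, Fin.cons_le] at hab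
  refine mem_densityHull.2 ⟨Fin.tail a, Fin.tail b, Finset.mem_Icc.2 ⟨hab.1.2, hab.2.2⟩, ?_⟩
  have hs : s ∈ Finset.Icc (a 0) (b 0) := Finset.mem_Icc.2 ⟨hab.1.1, hab.2.1⟩
  set I := Finset.Icc (a 0) (b 0)
  set Q := Finset.Icc (Fin.tail a) (Fin.tail b)
  have hcons (t : α) (z : Fin n → α) : Fin.cons t z ∈ Finset.Icc a b ↔ z ∈ Q ∧ t ∈ I := by
    simp only [Finset.mem_Icc, Fin.le_cons, Fin.cons_le, I, Q]
    tauto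
  rw [sum_eq_sum_sum_cons (Q := Q) (I := fun z => I \ ({t | Fin.cons t z ∈ E} : Finset α))
    fun t z => by simp [hcons, and_assoc], sum_eq_sum_sum_cons hcons] at hlt
  simp only [Fin.prod_univ_succ, Fin.cons_zero, Fin.cons_succ, ← Finset.sum_mul,
    ← Finset.mul_sum] at hlt
  have hI : 0 < η * ∑ t ∈ I, v t := mul_pos hη (Finset.sum_pos (fun t _ => hv t) ⟨s, hs⟩)
  have hnonneg (z : Fin n → α) : 0 ≤ ∏ i, v (z i) := Finset.prod_nonneg fun i _ => (hv _).le
  refine lt_of_mul_lt_mul_left (lt_of_le_of_lt ?_ (hlt.trans_eq (by ring))) hI.le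
  rw [Finset.mul_sum]
  refine (Finset.sum_le_sum fun z hz => ?_).trans (Finset.sum_le_sum_of_subset_of_nonneg
    Finset.sdiff_subset fun z _ _ =>
      mul_nonneg (Finset.sum_nonneg fun t _ => (hv t).le) (hnonneg z))
  -- Over a `z` outside the new set, at least the proportion `η` of the segment `I` misses `E`.
  refine mul_le_mul_of_nonneg_right (not_lt.1 fun hlt => ?_) (hnonneg z)
  exact (Finset.mem_sdiff.1 hz).2 (by simpa using mem_densityHull.2 ⟨a 0, b 0, hs, hlt⟩)

theorem sum_densityHull_prod_le (hv : ∀ t, 0 < v t) (hη : 0 < η) (hε : 0 ≤ ε)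
    (hε4 : 4 * ε ≤ 1) {W : (Fin n → α) → ℝ} (hW : ∀ x, 0 ≤ W x)
    (hline : ∀ x i, LineAInfty v (fun t => W (Function.update x i t)) η ε)
    (E : Finset (Fin n → α)) :
    ∑ x ∈ densityHull (fun y => ∏ i, v (y i)) (η ^ n) E, W x ≤ (1 + 4 * ε) ^ n * ∑ x ∈ E, W x := by
  induction n with
  | zero =>
    rw [pow_zero, pow_zero, one_mul]
    exact Finset.sum_le_sum_of_subset_of_nonneg (densityHull_one_subset _ E) fun x _ _ => hW x
  | succ n ih =>
    calc ∑ x ∈ densityHull (fun y => ∏ i, v (y i)) (η ^ (n + 1)) E, W x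
        = ∑ t, ∑ z with Fin.cons t z ∈ densityHull (fun y => ∏ i, v (y i)) (η ^ (n + 1)) E,
            W (Fin.cons t z) := by
          rw [sum_eq_sum_sum_cons (Q := Finset.univ) (I := fun z => {t | Fin.cons t z ∈
            densityHull (fun y => ∏ i, v (y i)) (η ^ (n + 1)) E}) (by simp)]
          exact Finset.sum_comm' (by simp)
      _ ≤ ∑ t, ∑ z ∈ densityHull (fun y => ∏ i, v (y i)) (η ^ n)
            {z | t ∈ densityHull v η {t | (Fin.cons t z : Fin (n + 1) → α) ∈ E}},
            W (Fin.cons t z) := by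
          refine Finset.sum_le_sum fun t _ => Finset.sum_le_sum_of_subset_of_nonneg
            (fun z hz => ?_) fun z _ _ => hW _
          exact mem_densityHull_of_cons_mem hv hη (Finset.mem_filter.1 hz).2
      _ ≤ ∑ t, (1 + 4 * ε) ^ n * ∑ z with t ∈ densityHull v η {t | Fin.cons t z ∈ E},
            W (Fin.cons t z) := by
          gcongr with t
          refine ih (fun z => hW _) (fun x i => ?_) _
          simpa only [Fin.cons_update] using hline (Fin.cons t x) i.succ
      _ = (1 + 4 * ε) ^ n * ∑ z, ∑ t ∈ densityHull v η {t | Fin.cons t z ∈ E},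
            W (Fin.cons t z) := by
          rw [← Finset.mul_sum]
          congr 1
          exact Finset.sum_comm' (by simp)
      _ ≤ (1 + 4 * ε) ^ n * ∑ z, (1 + 4 * ε) * ∑ t with Fin.cons t z ∈ E, W (Fin.cons t z) := by
          gcongr with z
          refine sum_densityHull_le_of_lineAInfty (fun t => hW _) hε hε4 (fun a b F hF hlt => ?_) _
          simpa only [Fin.update_cons_zero] using hline (Fin.cons a z) 0 a b F hF hlt
      _ = (1 + 4 * ε) ^ (n + 1) * ∑ x ∈ E, W x := by
          rw [← Finset.mul_sum, sum_eq_sum_sum_cons (C := E) (Q := Finset.univ)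
            (I := fun z => {t | Fin.cons t z ∈ E}) (by simp)]
          ring

end Slices

end Discrete

/-! ### Cylinders and grids -/

section Line

variable {ι : Type*}

/-- The restriction of `ω` to the cylinder in direction `i` over the box `B`, projected to that
direction: it replaces slices of `ω`, whose properties could only be controlled almost
everywhere. -/
noncomputable def lineMeasure (ω : Measure (ι → ℝ)) (B : BoxIntegral.Box ι) (i : ι) : Measure ℝ :=
  (ω.restrict (Set.pi {i}ᶜ fun j => Set.Ioc (B.lower j) (B.upper j))).map (Function.eval i)

theorem lineMeasure_apply (ω : Measure (ι → ℝ)) (B : BoxIntegral.Box ι) (i : ι) {T : Set ℝ}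
    (hT : MeasurableSet T) : lineMeasure ω B i T =
      ω (Function.eval i ⁻¹' T ∩ Set.pi {i}ᶜ fun j => Set.Ioc (B.lower j) (B.upper j)) := by
  rw [lineMeasure, Measure.map_apply (measurable_pi_apply i) hT,
    Measure.restrict_apply (measurable_pi_apply i hT)]

section ReplaceSide

variable [DecidableEq ι]

/-- The box `B` with its side in direction `i` replaced by `(s, t]`. -/
def replaceSide (B : BoxIntegral.Box ι) (i : ι) {s t : ℝ} (hst : s < t) : BoxIntegral.Box ι where
  lower := Function.update B.lower i s
  upper := Function.update B.upper i t
  lower_lt_upper j := by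
    rcases eq_or_ne j i with rfl | hji
    · simp [hst]
    · simp [hji]

theorem coe_replaceSide (B : BoxIntegral.Box ι) (i : ι) {s t : ℝ} (hst : s < t) :
    (replaceSide B i hst : Set (ι → ℝ)) =
      Function.eval i ⁻¹' Set.Ioc s t ∩ Set.pi {i}ᶜ fun j => Set.Ioc (B.lower j) (B.upper j) := by
  have hsides (j : ι) : Set.Ioc (Function.update B.lower i s j) (Function.update B.upper i t j) =
      Function.update (fun j => Set.Ioc (B.lower j) (B.upper j)) i (Set.Ioc s t) j := by
    rcases eq_or_ne j i with rfl | hji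
    · simp
    · simp [hji]
  rw [BoxIntegral.Box.coe_eq_pi]
  simp only [replaceSide, hsides]
  exact Set.univ_pi_update i _ _ fun _ T => T

theorem volume_real_replaceSide [Fintype ι] (B : BoxIntegral.Box ι) (i : ι) {s t : ℝ}
    (hst : s < t) : volume.real (replaceSide B i hst : Set (ι → ℝ)) =
      (∏ j ∈ {i}ᶜ, (B.upper j - B.lower j)) * (t - s) := by
  rw [measureReal_def, BoxIntegral.Box.volume_apply', Fintype.prod_eq_mul_prod_compl i, mul_comm]
  congr 1
  · refine Finset.prod_congr rfl fun j hj => ?_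
    have hji : j ≠ i := by simpa using hj
    simp [replaceSide, hji]
  · simp [replaceSide]

theorem lineMeasure_Ioc (ω : Measure (ι → ℝ)) (B : BoxIntegral.Box ι) (i : ι) {s t : ℝ}
    (hst : s < t) : lineMeasure ω B i (Set.Ioc s t) = ω (replaceSide B i hst) := by
  rw [lineMeasure_apply ω B i measurableSet_Ioc, coe_replaceSide]

theorem lineMeasure_real_Ioc (ω : Measure (ι → ℝ)) (B : BoxIntegral.Box ι) (i : ι) {s t : ℝ}
    (hst : s < t) : (lineMeasure ω B i).real (Set.Ioc s t) = ω.real (replaceSide B i hst) := by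
  rw [measureReal_def, measureReal_def, lineMeasure_Ioc]

end ReplaceSide

theorem SqrtComparable.of_forall_lt {ω σ : Measure ℝ} {K : ℝ}
    (h : SqrtComparable (fun I : {I : ℝ × ℝ // I.1 < I.2} => interval I) K ω σ) :
    SqrtComparable interval K ω σ := by
  constructor <;> intro I <;> rcases lt_or_ge I.1 I.2 with hI | hI
  · exact h.ne_top ⟨I, hI⟩
  · simp [interval, hI]
  · exact h.sqrt_ne_top ⟨I, hI⟩
  · simp [interval, hI]
  · exact h.sq_le ⟨I, hI⟩
  · simp [interval, hI]
  · exact h.mul_le ⟨I, hI⟩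
  · simp [interval, hI]

theorem SqrtComparable.exists_lineMeasure [Fintype ι] {ω σ : Measure (ι → ℝ)} {K : ℝ}
    (h : SqrtComparable (fun B : BoxIntegral.Box ι => (B : Set (ι → ℝ))) K ω σ)
    (B : BoxIntegral.Box ι) (i : ι) :
    ∃ ν : Measure ℝ, SqrtComparable interval K (lineMeasure ω B i) ν := by
  classical
  set q := ∏ j ∈ {i}ᶜ, (B.upper j - B.lower j)
  have hq : 0 < q := Finset.prod_pos fun j _ => sub_pos.2 (B.lower_lt_upper j)
  have hvolume {s t : ℝ} (hst : s < t) : volume.real (Set.Ioc s t) =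
      q⁻¹ * volume.real (replaceSide B i hst : Set (ι → ℝ)) := by
    rw [volume_real_replaceSide, inv_mul_cancel_left₀ hq.ne', Real.volume_real_Ioc_of_le hst.le]
  have hscale (x : ℝ) : ((√q)⁻¹ * x) ^ 2 = q⁻¹ * x ^ 2 := by
    rw [mul_pow, inv_pow, Real.sq_sqrt hq.le]
  refine ⟨ENNReal.ofReal (√q)⁻¹ • lineMeasure σ B i, .of_forall_lt ⟨?_, ?_, ?_, ?_⟩⟩ <;>
    rintro ⟨⟨s, t⟩, hst⟩ <;> have hst : s < t := hst
  · simpa [lineMeasure_Ioc ω B i hst] using h.ne_top _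
  · simpa [lineMeasure_Ioc σ B i hst] using
      ENNReal.mul_ne_top ENNReal.ofReal_ne_top (h.sqrt_ne_top (replaceSide B i hst))
  · rw [measureReal_ennreal_smul_apply, ENNReal.toReal_ofReal (by positivity), hscale,
      lineMeasure_real_Ioc _ _ _ hst, lineMeasure_real_Ioc _ _ _ hst, hvolume hst, mul_assoc]
    gcongr
    exact h.sq_le _
  · rw [measureReal_ennreal_smul_apply, ENNReal.toReal_ofReal (by positivity), hscale,
      lineMeasure_real_Ioc _ _ _ hst, lineMeasure_real_Ioc _ _ _ hst, hvolume hst, mul_assoc,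
      mul_left_comm K]
    exact mul_le_mul_of_nonneg_left (h.mul_le _) (inv_nonneg.2 hq.le)

end Line

section Grid

variable {m n : ℕ} {g : Fin (m + 1) → ℝ}

theorem exists_strictMono_subset_range (G : Finset ℝ) :
    ∃ (m : ℕ) (g : Fin (m + 1) → ℝ), StrictMono g ∧ (G : Set ℝ) ⊆ Set.range g := by
  obtain ⟨m, hm⟩ := Nat.exists_eq_add_one.2 (Finset.card_pos.2 (G.insert_nonempty 0))
  refine ⟨m, (insert 0 G).orderEmbOfFin hm, OrderEmbedding.strictMono _, ?_⟩
  rw [Finset.range_orderEmbOfFin]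
  exact Finset.coe_subset.2 (G.subset_insert 0)

/-- The intervals into which the points of the grid `g` divide the line. -/
abbrev gridSegment (g : Fin (m + 1) → ℝ) (t : Fin m) : Set ℝ := Set.Ioc (g t.castSucc) (g t.succ)

theorem pairwise_disjoint_gridSegment (hg : Monotone g) :
    Pairwise (Function.onFun Disjoint (gridSegment g)) :=
  (pairwise_disjoint_on _).2 fun _ _ hst =>
    Set.Ioc_disjoint_Ioc_of_le (hg (Fin.succ_le_castSucc_iff.2 hst))

theorem biUnion_gridSegment (hg : Monotone g) (a b : Fin m) :
    ⋃ t ∈ Set.Icc a b, gridSegment g t = Set.Ioc (g a.castSucc) (g b.succ) := by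
  refine (Set.iUnion₂_subset fun t ht => Set.Ioc_subset_Ioc
    (hg (Fin.castSucc_le_castSucc_iff.2 ht.1)) (hg (Fin.succ_le_succ_iff.2 ht.2))).antisymm
    fun x hx => ?_
  obtain ⟨k, hxk, hmin⟩ := Set.exists_min_image {k | x ≤ g k} id (Set.toFinite _) ⟨_, hx.2⟩
  have hak : a.castSucc < k := hg.reflect_lt (hx.1.trans_le hxk)
  obtain ⟨t, rfl⟩ := Fin.exists_succ_eq.2 (Fin.ne_zero_of_lt hak)
  have hgt : g t.castSucc < x := lt_of_not_ge fun hle => t.castSucc_lt_succ.not_ge (hmin _ hle)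
  exact Set.mem_biUnion ⟨Fin.castSucc_lt_succ_iff.1 hak, Fin.succ_le_succ_iff.1 (hmin _ hx.2)⟩
    ⟨hgt, hxk⟩

theorem sum_Icc_real_gridSegment (hg : Monotone g) {μ : Measure ℝ}
    (hμ : ∀ t, μ (gridSegment g t) ≠ ∞) (a b : Fin m) :
    ∑ t ∈ Finset.Icc a b, μ.real (gridSegment g t) =
      μ.real (Set.Ioc (g a.castSucc) (g b.succ)) := by
  rw [← measureReal_biUnion_finset ((pairwise_disjoint_gridSegment hg).set_pairwise _)
    (fun _ _ => measurableSet_Ioc) fun t _ => hμ t, ← biUnion_gridSegment hg]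
  simp

theorem SqrtComparable.lineAInfty_gridSegment {ω σ : Measure ℝ} {K η : ℝ}
    (h : SqrtComparable interval K ω σ) (hK : 1 ≤ K) (hη : 0 < η) (hη1 : η ≤ 1)
    (hg : StrictMono g) :
    LineAInfty (fun t => volume.real (gridSegment g t)) (fun t => ω.real (gridSegment g t)) η
      (9 * η ^ (1 / (64 * K))) := by
  intro a b F hF hlt
  rcases lt_or_ge b a with hba | hab
  · simp [Finset.subset_empty.1 (hF.trans_eq (Finset.Icc_eq_empty_of_lt hba)), hba]
  have hst : g a.castSucc < g b.succ := hg (Fin.castSucc_lt_succ_iff.2 hab)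
  have hω (t : Fin m) : ω (gridSegment g t) ≠ ∞ := h.ne_top (g t.castSucc, g t.succ)
  have hdisj := (pairwise_disjoint_gridSegment hg.monotone).set_pairwise (F : Set (Fin m))
  have hmeas (t : Fin m) (_ : t ∈ F) : MeasurableSet (gridSegment g t) := measurableSet_Ioc
  rw [sum_Icc_real_gridSegment hg.monotone (fun _ => measure_Ioc_lt_top.ne),
    Real.volume_real_Ioc_of_le hst.le,
    ← measureReal_biUnion_finset hdisj hmeas fun _ _ => measure_Ioc_lt_top.ne] at hlt
  rw [sum_Icc_real_gridSegment hg.monotone hω,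
    ← measureReal_biUnion_finset hdisj hmeas fun t _ => hω t]
  refine h.measureReal_le_of_subset_Ioc hK (F.measurableSet_biUnion hmeas) hη hη1 hst ?_ ?_
  · rw [← biUnion_gridSegment hg.monotone]
    exact Set.biUnion_mono (fun t ht => Finset.mem_Icc.1 (hF ht)) fun _ _ => subset_rfl
  · refine (ENNReal.lt_ofReal_iff_toReal_lt ?_).2 hlt
    exact (measure_biUnion_lt_top F.finite_toSet fun _ _ => measure_Ioc_lt_top).ne

/-- The cell with index `y` of the grid of which every coordinate is divided by `g`. -/
def gridBox (hg : StrictMono g) (y : Fin n → Fin m) : BoxIntegral.Box (Fin n) where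
  lower i := g (y i).castSucc
  upper i := g (y i).succ
  lower_lt_upper i := hg (y i).castSucc_lt_succ

theorem coe_gridBox (hg : StrictMono g) (y : Fin n → Fin m) :
    (gridBox hg y : Set (Fin n → ℝ)) = Set.univ.pi fun i => gridSegment g (y i) :=
  BoxIntegral.Box.coe_eq_pi _

theorem pairwise_disjoint_gridBox (hg : StrictMono g) :
    Pairwise (Function.onFun Disjoint
      fun y : Fin n → Fin m => (gridBox hg y : Set (Fin n → ℝ))) := by
  intro y z hyz
  obtain ⟨i, hi⟩ := Function.ne_iff.1 hyz
  rw [Function.onFun, coe_gridBox, coe_gridBox, Set.disjoint_univ_pi]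
  exact ⟨i, pairwise_disjoint_gridSegment hg.monotone hi⟩

theorem biUnion_gridBox (hg : StrictMono g) (a b : Fin n → Fin m) :
    ⋃ y ∈ Set.Icc a b, (gridBox hg y : Set (Fin n → ℝ)) =
      Set.univ.pi fun i => Set.Ioc (g (a i).castSucc) (g (b i).succ) := by
  have hsides (i : Fin n) : Set.Ioc (g (a i).castSucc) (g (b i).succ) =
      ⋃ t ∈ Set.Icc (a i) (b i), gridSegment g t := (biUnion_gridSegment hg.monotone _ _).symm
  simp only [coe_gridBox, hsides, ← Set.pi_univ_Icc]
  exact Set.biUnion_univ_pi _ _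

theorem replaceSide_gridBox (hg : StrictMono g) (x : Fin n → Fin m) (i : Fin n) (t : Fin m) :
    replaceSide (gridBox hg x) i (hg t.castSucc_lt_succ) = gridBox hg (Function.update x i t) := by
  simp only [replaceSide, gridBox, BoxIntegral.Box.mk.injEq]
  constructor <;> funext j <;> rcases eq_or_ne j i with rfl | hji <;> simp [*]

theorem volume_real_gridBox (hg : StrictMono g) (y : Fin n → Fin m) :
    volume.real (gridBox hg y : Set (Fin n → ℝ)) = ∏ i, volume.real (gridSegment g (y i)) := by
  simp only [measureReal_def, BoxIntegral.Box.volume_apply', gridBox, Real.volume_Ioc]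
  exact Finset.prod_congr rfl fun i _ =>
    (ENNReal.toReal_ofReal (sub_nonneg.2 (hg.monotone (Fin.castSucc_le_succ _)))).symm

theorem SqrtComparable.lineAInfty_gridBox {ω σ : Measure (Fin n → ℝ)} {K η : ℝ}
    (h : SqrtComparable (fun B : BoxIntegral.Box (Fin n) => (B : Set (Fin n → ℝ))) K ω σ)
    (hK : 1 ≤ K) (hη : 0 < η) (hη1 : η ≤ 1) (hg : StrictMono g) (x : Fin n → Fin m) (i : Fin n) :
    LineAInfty (fun t => volume.real (gridSegment g t))
      (fun t => ω.real (gridBox hg (Function.update x i t))) η (9 * η ^ (1 / (64 * K))) := by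
  obtain ⟨ν, hν⟩ := h.exists_lineMeasure (gridBox hg x) i
  simpa only [← replaceSide_gridBox, lineMeasure_real_Ioc _ _ _ (hg Fin.castSucc_lt_succ)]
    using hν.lineAInfty_gridSegment hK hη hη1 hg

theorem exists_gridBox_biUnion_eq {κ : Type*} [Finite κ] (R : κ → BoxIntegral.Box (Fin n)) :
    ∃ (m : ℕ) (g : Fin (m + 1) → ℝ) (hg : StrictMono g) (a b : κ → Fin n → Fin m),
      ∀ j, (R j : Set (Fin n → ℝ)) = ⋃ y ∈ Set.Icc (a j) (b j), gridBox hg y := by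
  have := Fintype.ofFinite κ
  obtain ⟨m, g, hg, hG⟩ := exists_strictMono_subset_range
    (Finset.univ.image (fun z : κ × Fin n => (R z.1).lower z.2) ∪
      Finset.univ.image fun z : κ × Fin n => (R z.1).upper z.2)
  have hside (j : κ) (i : Fin n) : ∃ a b : Fin m,
      g a.castSucc = (R j).lower i ∧ g b.succ = (R j).upper i := by
    obtain ⟨k, hk⟩ := hG (a := (R j).lower i) (by simp)
    obtain ⟨l, hl⟩ := hG (a := (R j).upper i) (by simp)
    have hkl : k < l := hg.lt_iff_lt.1 (by rw [hk, hl]; exact (R j).lower_lt_upper i)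
    obtain ⟨a, rfl⟩ := Fin.exists_castSucc_eq.2 (Fin.ne_last_of_lt hkl)
    obtain ⟨b, rfl⟩ := Fin.exists_succ_eq.2 (Fin.ne_zero_of_lt hkl)
    exact ⟨a, b, hk, hl⟩
  choose a b ha hb using hside
  refine ⟨m, g, hg, a, b, fun j => ?_⟩
  rw [biUnion_gridBox, BoxIntegral.Box.coe_eq_pi]
  simp only [ha, hb]

theorem measureReal_biUnion_gridBox (hg : StrictMono g) {μ : Measure (Fin n → ℝ)}
    (hμ : ∀ B : BoxIntegral.Box (Fin n), μ B ≠ ∞) (T : Finset (Fin n → Fin m)) :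
    μ.real (⋃ y ∈ T, gridBox hg y) = ∑ y ∈ T, μ.real (gridBox hg y) :=
  measureReal_biUnion_finset ((pairwise_disjoint_gridBox hg).set_pairwise _)
    (fun _ _ => BoxIntegral.Box.measurableSet_coe _) fun _ _ => hμ _

theorem biUnion_gridBox_sdiff_biUnion_gridBox (hg : StrictMono g) (T U : Finset (Fin n → Fin m)) :
    ((⋃ y ∈ T, (gridBox hg y : Set (Fin n → ℝ))) \ ⋃ y ∈ U, gridBox hg y) =
      ⋃ y ∈ T \ U, gridBox hg y := by
  simpa using Set.biUnion_sdiff_biUnion_eq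
    ((pairwise_disjoint_gridBox (n := n) hg).set_pairwise (T ∪ U : Set (Fin n → Fin m)))

theorem SqrtComparable.sum_densityHull_gridBox_le {ω σ : Measure (Fin n → ℝ)} {K η : ℝ}
    (h : SqrtComparable (fun B : BoxIntegral.Box (Fin n) => (B : Set (Fin n → ℝ))) K ω σ)
    (hK : 1 ≤ K) (hη : 0 < η) (hsmall : 36 * η ^ (1 / (64 * K)) ≤ 1) (hg : StrictMono g)
    (E : Finset (Fin n → Fin m)) :
    ∑ y ∈ densityHull (fun y => volume.real (gridBox hg y : Set (Fin n → ℝ))) (η ^ n) E,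
        ω.real (gridBox hg y) ≤
      (1 + 36 * η ^ (1 / (64 * K))) ^ n * ∑ y ∈ E, ω.real (gridBox hg y) := by
  have hη1 : η ≤ 1 := by
    by_contra! hη1
    linarith [Real.one_lt_rpow hη1 (by positivity : 0 < 1 / (64 * K))]
  have hlength (t : Fin m) : 0 < volume.real (gridSegment g t) := by
    rw [Real.volume_real_Ioc_of_le (hg Fin.castSucc_lt_succ).le]
    exact sub_pos.2 (hg Fin.castSucc_lt_succ)
  have hbound := sum_densityHull_prod_le hlength hη (ε := 9 * η ^ (1 / (64 * K))) (by positivity)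
    (by linarith) (W := fun y => ω.real (gridBox hg y)) (fun _ => measureReal_nonneg)
    (h.lineAInfty_gridBox hK hη hη1 hg) E
  simpa only [volume_real_gridBox, ← mul_assoc, show (4 : ℝ) * 9 = 36 by norm_num] using hbound

theorem SqrtComparable.measureReal_iUnion_box_le {κ : Type*} [Finite κ]
    {ω σ : Measure (Fin n → ℝ)} {K η : ℝ}
    (h : SqrtComparable (fun B : BoxIntegral.Box (Fin n) => (B : Set (Fin n → ℝ))) K ω σ)
    (hK : 1 ≤ K) (hη : 0 < η) (hsmall : 36 * η ^ (1 / (64 * K)) ≤ 1)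
    (R : κ → BoxIntegral.Box (Fin n)) (S : Finset κ)
    (hS : ∀ j, volume.real ((R j : Set (Fin n → ℝ)) \ ⋃ k ∈ S, (R k : Set (Fin n → ℝ))) <
      η ^ n * volume.real (R j : Set (Fin n → ℝ))) :
    ω.real (⋃ j, (R j : Set (Fin n → ℝ))) ≤
      (1 + 36 * η ^ (1 / (64 * K))) ^ n * ω.real (⋃ k ∈ S, (R k : Set (Fin n → ℝ))) := by
  classical
  obtain ⟨m, g, hg, a, b, hR⟩ := exists_gridBox_biUnion_eq R
  have hcells (j : κ) : (R j : Set (Fin n → ℝ)) =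
      ⋃ y ∈ Finset.Icc (a j) (b j), gridBox hg y := by
    simp only [hR, Finset.mem_Icc, Set.mem_Icc]
  set E := S.biUnion fun k => Finset.Icc (a k) (b k)
  have hE : ⋃ k ∈ S, (R k : Set (Fin n → ℝ)) = ⋃ y ∈ E, (gridBox hg y : Set (Fin n → ℝ)) := by
    simp only [hcells, E, Finset.set_biUnion_biUnion]
  set H := densityHull (fun y => volume.real (gridBox hg y : Set (Fin n → ℝ))) (η ^ n) E
  have hH : ⋃ j, (R j : Set (Fin n → ℝ)) ⊆ ⋃ y ∈ H, gridBox hg y := by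
    refine Set.iUnion_subset fun j => (hcells j).trans_subset ?_
    refine Set.biUnion_mono (fun y hy => mem_densityHull.2 ⟨a j, b j, hy, ?_⟩) fun _ _ => subset_rfl
    have hvolume (T : Finset (Fin n → Fin m)) :=
      measureReal_biUnion_gridBox hg (fun B => (B.measure_coe_lt_top volume).ne) T
    rw [← hvolume, ← hvolume, ← biUnion_gridBox_sdiff_biUnion_gridBox, ← hE, ← hcells]
    exact hS j
  calc ω.real (⋃ j, (R j : Set (Fin n → ℝ))) ≤ ω.real (⋃ y ∈ H, gridBox hg y) :=
        measureReal_mono hH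
          (measure_biUnion_lt_top H.finite_toSet fun _ _ => (h.ne_top _).lt_top).ne
    _ = ∑ y ∈ H, ω.real (gridBox hg y) := measureReal_biUnion_gridBox hg h.ne_top H
    _ ≤ (1 + 36 * η ^ (1 / (64 * K))) ^ n * ∑ y ∈ E, ω.real (gridBox hg y) :=
        h.sum_densityHull_gridBox_le hK hη hsmall hg E
    _ = _ := by rw [hE, measureReal_biUnion_gridBox hg h.ne_top]

end Grid

/-! ### Strong Muckenhoupt weights -/

section Holder

variable {α : Type*} [MeasurableSpace α] {μ : Measure α} {f : α → ℝ≥0∞} {s : ℝ}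

theorem measure_univ_rpow_le_lintegral_rpow_mul_lintegral_rpow_neg (hf : AEMeasurable f μ)
    (hf0 : ∀ᵐ x ∂μ, f x ≠ 0) (hf_top : ∀ᵐ x ∂μ, f x ≠ ∞) {r : ℝ} (hs : 0 < s) (hr : 0 < r) :
    μ Set.univ ^ (1 / s + 1 / r) ≤
      (∫⁻ x, f x ^ s ∂μ) ^ (1 / s) * (∫⁻ x, f x ^ (-r) ∂μ) ^ (1 / r) := by
  set q := 1 / s + 1 / r
  have hq : 0 < q := by positivity
  have hone : ∀ᵐ x ∂μ, (f x ^ s) ^ (1 / s / q) * (f x ^ (-r)) ^ (1 / r / q) = 1 := by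
    filter_upwards [hf0, hf_top] with x hx0 hx_top
    rw [← ENNReal.rpow_mul, ← ENNReal.rpow_mul, ← ENNReal.rpow_add _ _ hx0 hx_top,
      show s * (1 / s / q) + -r * (1 / r / q) = 0 by field_simp; ring, ENNReal.rpow_zero]
  calc μ Set.univ ^ q
      = (∫⁻ x, (f x ^ s) ^ (1 / s / q) * (f x ^ (-r)) ^ (1 / r / q) ∂μ) ^ q := by
        rw [lintegral_congr_ae hone, lintegral_one]
    _ ≤ ((∫⁻ x, f x ^ s ∂μ) ^ (1 / s / q) * (∫⁻ x, f x ^ (-r) ∂μ) ^ (1 / r / q)) ^ q := by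
        gcongr
        exact ENNReal.lintegral_mul_norm_pow_le (hf.pow_const _) (hf.pow_const _) (by positivity)
          (by positivity) (by rw [← add_div, div_self hq.ne'])
    _ = _ := by
        rw [ENNReal.mul_rpow_of_nonneg _ _ hq.le, ← ENNReal.rpow_mul, ← ENNReal.rpow_mul,
          div_mul_cancel₀ _ hq.ne', div_mul_cancel₀ _ hq.ne']

theorem measure_univ_rpow_le_lintegral_rpow_mul_essSup_inv (hf : AEMeasurable f μ)
    (hf0 : ∀ᵐ x ∂μ, f x ≠ 0) (hf_top : ∀ᵐ x ∂μ, f x ≠ ∞) (hs : 0 < s) :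
    μ Set.univ ^ (1 / s) ≤ (∫⁻ x, f x ^ s ∂μ) ^ (1 / s) * essSup (fun x => (f x)⁻¹) μ := by
  set D := essSup (fun x => (f x)⁻¹) μ
  have hD : μ Set.univ ≤ ∫⁻ x, f x ^ s * D ^ s ∂μ := by
    rw [← lintegral_one]
    refine lintegral_mono_ae ?_
    filter_upwards [hf0, hf_top, ae_le_essSup (f := fun x => (f x)⁻¹)] with x hx0 hx_top hxD
    have hone : 1 ≤ f x * D := by
      rw [← ENNReal.mul_inv_cancel hx0 hx_top]
      gcongr
    simpa only [ENNReal.mul_rpow_of_nonneg _ _ hs.le] using ENNReal.one_le_rpow hone hs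
  calc μ Set.univ ^ (1 / s) ≤ ((∫⁻ x, f x ^ s ∂μ) * D ^ s) ^ (1 / s) := by
        rw [← lintegral_mul_const'' _ (hf.pow_const _)]
        gcongr
    _ = _ := by
        rw [ENNReal.mul_rpow_of_nonneg _ _ (by positivity), ← ENNReal.rpow_mul D,
          mul_one_div_cancel hs.ne', ENNReal.rpow_one]

theorem lintegral_rpow_half_sq_le (hf : AEMeasurable f μ) :
    (∫⁻ x, f x ^ (1 / 2 : ℝ) ∂μ) ^ 2 ≤ μ Set.univ * ∫⁻ x, f x ∂μ := by
  have h := ENNReal.lintegral_mul_norm_pow_le (p := 1 / 2) (q := 1 / 2)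
    (aemeasurable_const (b := 1)) hf (by norm_num) (by norm_num) (by norm_num)
  simp only [ENNReal.one_rpow, one_mul, lintegral_const] at h
  calc (∫⁻ x, f x ^ (1 / 2 : ℝ) ∂μ) ^ 2
      ≤ (μ Set.univ ^ (1 / 2 : ℝ) * (∫⁻ x, f x ∂μ) ^ (1 / 2 : ℝ)) ^ 2 := by gcongr
    _ = _ := by
        rw [mul_pow, ← ENNReal.rpow_mul_natCast, ← ENNReal.rpow_mul_natCast]
        norm_num

end Holder

section Weight

variable {n : ℕ} {p s : ℝ} {w : (Fin n → ℝ) → ℝ}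

theorem measurableSet_rectangle (B : BoxIntegral.Box (Fin n)) : MeasurableSet (rectangle B) :=
  measurableSet_Icc

theorem isCompact_rectangle (B : BoxIntegral.Box (Fin n)) : IsCompact (rectangle B) :=
  isCompact_Icc

theorem volume_rectangle_ne_top (B : BoxIntegral.Box (Fin n)) : volume (rectangle B) ≠ ∞ :=
  (isCompact_rectangle B).measure_lt_top.ne

theorem volume_rectangle_ne_zero (B : BoxIntegral.Box (Fin n)) : volume (rectangle B) ≠ 0 := by
  rw [rectangle, Real.volume_Icc_pi]
  exact Finset.prod_ne_zero_iff.2 fun i _ => by simp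

theorem volume_real_rectangle_pos (B : BoxIntegral.Box (Fin n)) :
    0 < volume.real (rectangle B) :=
  ENNReal.toReal_pos (volume_rectangle_ne_zero B) (volume_rectangle_ne_top B)

/-- The measure `w ^ s dx`; the exponent `1` gives the weight itself and `1 / 2` its companion in
`SqrtComparable`. -/
noncomputable def powMeasure (w : (Fin n → ℝ) → ℝ) (s : ℝ) : Measure (Fin n → ℝ) :=
  volume.withDensity fun x => ENNReal.ofReal (w x) ^ s

theorem powMeasure_apply (w : (Fin n → ℝ) → ℝ) (s : ℝ) (E : Set (Fin n → ℝ)) :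
    powMeasure w s E = ∫⁻ x in E, ENNReal.ofReal (w x) ^ s :=
  withDensity_apply' _ _

theorem powMeasure_one_apply (w : (Fin n → ℝ) → ℝ) (E : Set (Fin n → ℝ)) :
    powMeasure w 1 E = ∫⁻ x in E, ENNReal.ofReal (w x) := by
  simp only [powMeasure_apply, ENNReal.rpow_one]

theorem IsWeight.aemeasurable_ofReal (hw : IsWeight w) :
    AEMeasurable fun x => ENNReal.ofReal (w x) :=
  hw.locallyIntegrable.aestronglyMeasurable.aemeasurable.ennreal_ofReal

theorem IsWeight.weightOf_eq (hw : IsWeight w) (E : Set (Fin n → ℝ)) :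
    weightOf w E = (powMeasure w 1).real E := by
  rw [weightOf, integral_eq_lintegral_of_nonneg_ae (ae_of_all _ hw.nonneg)
    hw.locallyIntegrable.aestronglyMeasurable.restrict, measureReal_def, powMeasure_one_apply]

theorem IsWeight.powMeasure_ne_top (hw : IsWeight w) (hs0 : 0 ≤ s) (hs1 : s ≤ 1)
    {E F : Set (Fin n → ℝ)} (hF : IsCompact F) (hEF : E ⊆ F) : powMeasure w s E ≠ ∞ := by
  refine measure_ne_top_of_subset hEF (ne_top_of_le_ne_top (b := volume F + powMeasure w 1 F) ?_ ?_)
  · rw [powMeasure_one_apply]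
    exact ENNReal.add_ne_top.2 ⟨hF.measure_lt_top.ne,
      (hw.locallyIntegrable.integrableOn_isCompact hF).lintegral_lt_top.ne⟩
  · rw [powMeasure_apply, powMeasure_one_apply, ← setLIntegral_one,
      ← lintegral_add_left measurable_const]
    refine lintegral_mono fun x => ?_
    rcases le_total (ENNReal.ofReal (w x)) 1 with hx | hx
    · exact (ENNReal.rpow_le_one hx hs0).trans le_self_add
    · exact ((ENNReal.rpow_le_rpow_of_exponent_le hx hs1).trans_eq (ENNReal.rpow_one _)).trans
        le_add_self

theorem ae_ne_zero_of_dualFactor_ne_top (hp : 1 ≤ p)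
    (hw : AEMeasurable fun x => ENNReal.ofReal (w x)) {F : Set (Fin n → ℝ)} (hF : volume F ≠ ∞)
    (h : dualFactor p w F ≠ ∞) : ∀ᵐ x ∂volume.restrict F, ENNReal.ofReal (w x) ≠ 0 := by
  unfold dualFactor at h
  split_ifs at h with hp1
  · filter_upwards [ae_le_essSup (μ := volume.restrict F)
      (f := fun x => (ENNReal.ofReal (w x))⁻¹)] with x hx hx0
    rw [hx0, ENNReal.inv_zero, top_le_iff] at hx
    exact h hx
  · have hp1 : 0 < p - 1 := sub_pos.2 (lt_of_le_of_ne hp (Ne.symm hp1))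
    have hexponent : -(1 / (p - 1)) < 0 := neg_neg_of_pos (by positivity)
    have hfinite : ∫⁻ x in F, ENNReal.ofReal (w x) ^ (-(1 / (p - 1))) ≠ ∞ := fun htop => by
      rw [htop, ENNReal.mul_top (ENNReal.inv_ne_zero.2 hF), ENNReal.top_rpow_of_pos hp1] at h
      exact h rfl
    filter_upwards [ae_lt_top' (hw.restrict.pow_const _) hfinite] with x hx hx0
    rw [hx0, ENNReal.zero_rpow_of_neg hexponent] at hx
    exact hx.false

theorem volume_rpow_le_powMeasure_mul_dualFactor (hp : 1 ≤ p) (hs : 0 < s)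
    (hw : AEMeasurable fun x => ENNReal.ofReal (w x)) {E F : Set (Fin n → ℝ)} (hEF : E ⊆ F)
    (hF0 : volume F ≠ 0) (hF : volume F ≠ ∞)
    (hpos : ∀ᵐ x ∂volume.restrict F, ENNReal.ofReal (w x) ≠ 0) :
    volume E ^ (1 / s + (p - 1)) ≤
      powMeasure w s E ^ (1 / s) * (volume F ^ (p - 1) * dualFactor p w F) := by
  have hposE := ae_restrict_of_ae_restrict_of_subset hEF hpos
  have hfinite : ∀ᵐ x ∂volume.restrict E, ENNReal.ofReal (w x) ≠ ∞ :=
    ae_of_all _ fun _ => ENNReal.ofReal_ne_top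
  rw [powMeasure_apply, ← Measure.restrict_apply_univ]
  unfold dualFactor
  split_ifs with hp1
  · rw [hp1, sub_self, add_zero, ENNReal.rpow_zero, one_mul]
    refine (measure_univ_rpow_le_lintegral_rpow_mul_essSup_inv hw.restrict hposE hfinite
      hs).trans ?_
    gcongr
    exact essSup_mono_measure (Measure.restrict_mono hEF le_rfl).absolutelyContinuous
  · have hp1 : 0 < p - 1 := sub_pos.2 (lt_of_le_of_ne hp (Ne.symm hp1))
    rw [← ENNReal.mul_rpow_of_nonneg _ _ hp1.le, ENNReal.mul_inv_cancel_left hF0 hF]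
    have hholder := measure_univ_rpow_le_lintegral_rpow_mul_lintegral_rpow_neg hw.restrict hposE
      hfinite hs (one_div_pos.2 hp1)
    rw [one_div_one_div] at hholder
    refine hholder.trans ?_
    gcongr

theorem MemApStar.volume_rpow_mul_le (hp : 1 ≤ p) (hs : 0 < s) (hw : MemApStar p w)
    (B : BoxIntegral.Box (Fin n)) {E : Set (Fin n → ℝ)} (hE : E ⊆ rectangle B) :
    volume E ^ (1 / s + (p - 1)) * powMeasure w 1 (rectangle B) ≤
      apRec p w * volume (rectangle B) ^ p * powMeasure w s E ^ (1 / s) := by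
  have hv0 := volume_rectangle_ne_zero B
  have hv := volume_rectangle_ne_top B
  rcases eq_or_ne (powMeasure w 1 (rectangle B)) 0 with hzero | hzero
  · simp [hzero]
  have hK : (volume (rectangle B))⁻¹ * powMeasure w 1 (rectangle B) *
      dualFactor p w (rectangle B) ≤ apRec p w := by
    rw [powMeasure_one_apply]
    exact le_iSup (fun R : BoxIntegral.Box (Fin n) => (volume (rectangle R))⁻¹ *
      (∫⁻ x in rectangle R, ENNReal.ofReal (w x)) * dualFactor p w (rectangle R)) B
  have hdual : dualFactor p w (rectangle B) ≠ ∞ := fun htop => by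
    rw [htop, ENNReal.mul_top (mul_ne_zero (ENNReal.inv_ne_zero.2 hv) hzero)] at hK
    exact hw.2.ne (top_le_iff.1 hK)
  have hpos := ae_ne_zero_of_dualFactor_ne_top hp hw.1.aemeasurable_ofReal hv hdual
  calc volume E ^ (1 / s + (p - 1)) * powMeasure w 1 (rectangle B)
      ≤ powMeasure w s E ^ (1 / s) * (volume (rectangle B) ^ (p - 1) *
          dualFactor p w (rectangle B)) * powMeasure w 1 (rectangle B) := by
        gcongr
        exact volume_rpow_le_powMeasure_mul_dualFactor hp hs hw.1.aemeasurable_ofReal hE hv0 hv hpos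
    _ = (volume (rectangle B))⁻¹ * powMeasure w 1 (rectangle B) * dualFactor p w (rectangle B) *
          volume (rectangle B) ^ p * powMeasure w s E ^ (1 / s) := by
        rw [ENNReal.rpow_sub _ _ hv0 hv, ENNReal.rpow_one, div_eq_mul_inv (_ ^ p)]
        ring
    _ ≤ apRec p w * volume (rectangle B) ^ p * powMeasure w s E ^ (1 / s) := by gcongr

theorem MemApStar.volume_real_rpow_mul_le (hp : 1 ≤ p) (hs0 : 0 < s) (hs1 : s ≤ 1)
    (hw : MemApStar p w) (B : BoxIntegral.Box (Fin n)) {E : Set (Fin n → ℝ)}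
    (hE : E ⊆ rectangle B) :
    volume.real E ^ (1 / s + (p - 1)) * (powMeasure w 1).real (rectangle B) ≤
      (apRec p w).toReal * volume.real (rectangle B) ^ p * (powMeasure w s).real E ^ (1 / s) := by
  have h := ENNReal.toReal_mono (ENNReal.mul_ne_top (ENNReal.mul_ne_top hw.2.ne
    (ENNReal.rpow_ne_top_of_nonneg (by linarith) (volume_rectangle_ne_top B)))
    (ENNReal.rpow_ne_top_of_nonneg (by positivity)
      (hw.1.powMeasure_ne_top hs0.le hs1 (isCompact_rectangle B) hE)))
    (hw.volume_rpow_mul_le hp hs0 B hE)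
  simpa only [measureReal_def, ENNReal.toReal_mul, ENNReal.toReal_rpow] using h

theorem MemApStar.sqrtComparable (hp : 1 ≤ p) (hw : MemApStar p w) :
    SqrtComparable (fun B : BoxIntegral.Box (Fin n) => (B : Set (Fin n → ℝ))) (apRec p w).toReal
      (powMeasure w 1) (powMeasure w (1 / 2)) := by
  have hω (B : BoxIntegral.Box (Fin n)) : powMeasure w 1 (rectangle B) ≠ ∞ :=
    hw.1.powMeasure_ne_top zero_le_one le_rfl (isCompact_rectangle B) subset_rfl
  have hsubset (B : BoxIntegral.Box (Fin n)) : (B : Set (Fin n → ℝ)) ⊆ rectangle B :=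
    B.coe_subset_Icc
  refine ⟨fun B => measure_ne_top_of_subset (hsubset B) (hω B), fun B =>
    hw.1.powMeasure_ne_top (by norm_num) (by norm_num) (isCompact_rectangle B) (hsubset B),
    fun B => ?_, fun B => ?_⟩
  · have h := lintegral_rpow_half_sq_le
      (hw.1.aemeasurable_ofReal.restrict (s := (B : Set (Fin n → ℝ))))
    rw [← powMeasure_apply, ← powMeasure_one_apply, Measure.restrict_apply_univ] at h
    simpa only [measureReal_def, ENNReal.toReal_pow, ENNReal.toReal_mul] using ENNReal.toReal_mono
      (ENNReal.mul_ne_top (B.measure_coe_lt_top _).ne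
        (measure_ne_top_of_subset (hsubset B) (hω B))) h
  · have h := hw.volume_real_rpow_mul_le hp (s := 1 / 2) (by norm_num) (by norm_num) B (hsubset B)
    have hvolume : volume.real (rectangle B) = volume.real (B : Set (Fin n → ℝ)) :=
      (measureReal_congr B.coe_ae_eq_Icc).symm
    have hv : 0 < volume.real (B : Set (Fin n → ℝ)) := hvolume ▸ volume_real_rectangle_pos B
    rw [hvolume, show 1 / (1 / 2 : ℝ) + (p - 1) = p + 1 by ring, Real.rpow_add hv, Real.rpow_one,
      show 1 / (1 / 2 : ℝ) = 2 by norm_num, Real.rpow_two, mul_assoc,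
      mul_comm (apRec p w).toReal, mul_assoc, mul_le_mul_iff_right₀ (by positivity)] at h
    refine le_trans ?_ h
    gcongr
    exacts [hω B, hsubset B]

theorem MemApStar.weightOf_rectangle_le (hp : 1 ≤ p) (hw : MemApStar p w)
    (B : BoxIntegral.Box (Fin n)) {E : Set (Fin n → ℝ)} (hE : E ⊆ rectangle B) {δ : ℝ}
    (hδ : 0 < δ) (hEδ : δ * volume.real (rectangle B) ≤ volume.real E) :
    weightOf w (rectangle B) ≤ (apRec p w).toReal / δ ^ p * weightOf w E := by
  have h := hw.volume_real_rpow_mul_le hp one_pos le_rfl B hE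
  have hv := volume_real_rectangle_pos B
  rw [hw.1.weightOf_eq, hw.1.weightOf_eq, div_mul_eq_mul_div, le_div_iff₀ (by positivity)]
  rw [div_one, Real.rpow_one, add_sub_cancel] at h
  refine le_of_mul_le_mul_left ?_ (Real.rpow_pos_of_pos hv p)
  calc volume.real (rectangle B) ^ p * ((powMeasure w 1).real (rectangle B) * δ ^ p)
      = (δ * volume.real (rectangle B)) ^ p * (powMeasure w 1).real (rectangle B) := by
        rw [Real.mul_rpow hδ.le hv.le]
        ring
    _ ≤ volume.real E ^ p * (powMeasure w 1).real (rectangle B) := by gcongr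
    _ ≤ (apRec p w).toReal * volume.real (rectangle B) ^ p * (powMeasure w 1).real E := h
    _ = _ := by ring

end Weight

/-! ### The Córdoba–Fefferman selection -/

section Solyanik

variable {n : ℕ} {p δ : ℝ} {w : (Fin n → ℝ) → ℝ}

theorem thirty_six_mul_rpow_le_one {x : ℝ} (hδ : 0 ≤ δ) (hx : 0 < x)
    (hδx : δ ≤ Real.exp (-(4 * x))) : 36 * δ ^ (1 / x) ≤ 1 := by
  have h36 : 36 ≤ Real.exp 4 := by
    calc (36 : ℝ) ≤ 2.7 ^ 4 := by norm_num
      _ ≤ Real.exp 1 ^ 4 := by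
        gcongr
        linarith [Real.exp_one_gt_d9]
      _ = Real.exp 4 := by
        rw [← Real.exp_nat_mul]
        norm_num
  calc 36 * δ ^ (1 / x) ≤ Real.exp 4 * Real.exp (-(4 * x)) ^ (1 / x) := by gcongr
    _ = 1 := by
      rw [← Real.exp_mul, ← Real.exp_add, neg_mul, mul_assoc, mul_one_div_cancel hx.ne', mul_one,
        add_neg_cancel, Real.exp_zero]

theorem one_add_mul_pow_le_of_le_one {a x : ℝ} (ha : 0 ≤ a) (hx0 : 0 ≤ x) (hx1 : x ≤ 1) (n : ℕ) :
    (1 + a * x) ^ n ≤ 1 + (1 + a) ^ n * x := by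
  have h := (convexOn_pow n).2 (Set.mem_Ici.2 zero_le_one)
    (Set.mem_Ici.2 (by positivity : 0 ≤ 1 + a)) (sub_nonneg.2 hx1) hx0 (sub_add_cancel 1 x)
  simp only [smul_eq_mul, one_pow, mul_one] at h
  calc (1 + a * x) ^ n = (1 - x + x * (1 + a)) ^ n := by ring
    _ ≤ 1 - x + x * (1 + a) ^ n := h
    _ ≤ _ := by linarith

theorem MemApStar.measureReal_iUnion_box_le (hn : n ≠ 0) (hp : 1 ≤ p) (hw : MemApStar p w)
    (hK : 1 ≤ (apRec p w).toReal) (hδ : 0 < δ)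
    (hδK : δ ≤ Real.exp (-(256 * n * (apRec p w).toReal))) {κ : Type*} [Finite κ]
    (R : κ → BoxIntegral.Box (Fin n)) (S : Finset κ)
    (hS : ∀ j, volume.real ((R j : Set (Fin n → ℝ)) \ ⋃ k ∈ S, (R k : Set (Fin n → ℝ))) <
      δ * volume.real (R j : Set (Fin n → ℝ))) :
    (powMeasure w 1).real (⋃ j, (R j : Set (Fin n → ℝ))) ≤
      (1 + 37 ^ n * δ ^ (1 / (256 * n * (apRec p w).toReal))) *
        (powMeasure w 1).real (⋃ k ∈ S, (R k : Set (Fin n → ℝ))) := by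
  set K := (apRec p w).toReal
  have : (0 : ℝ) < n := by positivity
  have hδ1 : δ ≤ 1 := hδK.trans (Real.exp_le_one_iff.2 (neg_nonpos.2 (by positivity)))
  set η := δ ^ (1 / (n : ℝ)) with hη
  have hηn : η ^ n = δ := by rw [hη, one_div, Real.rpow_inv_natCast_pow hδ.le hn]
  have hηK : η ^ (1 / (64 * K)) = δ ^ (1 / (64 * n * K)) := by
    rw [hη, ← Real.rpow_mul hδ.le]
    congr 1
    field_simp
  have hsmall : 36 * η ^ (1 / (64 * K)) ≤ 1 := by
    rw [hηK]
    exact thirty_six_mul_rpow_le_one hδ.le (by positivity) (hδK.trans_eq (by ring_nf))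
  refine (hw.sqrtComparable hp |>.measureReal_iUnion_box_le hK (by positivity) hsmall R S
    (by rwa [hηn])).trans (mul_le_mul_of_nonneg_right ?_ measureReal_nonneg)
  calc (1 + 36 * η ^ (1 / (64 * K))) ^ n
      ≤ (1 + 36 * δ ^ (1 / (256 * n * K))) ^ n := by
        rw [hηK]
        have hexponent : 1 / (256 * n * K) ≤ 1 / (64 * n * K) := by gcongr; norm_num
        have hpow := Real.rpow_le_rpow_of_exponent_ge hδ hδ1 hexponent
        gcongr
    _ ≤ 1 + (1 + 36) ^ n * δ ^ (1 / (256 * n * K)) :=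
        one_add_mul_pow_le_of_le_one (by norm_num) (by positivity)
          (Real.rpow_le_one hδ.le hδ1 (by positivity)) n
    _ = _ := by norm_num

theorem MemApStar.weightOf_iUnion_le (hn : n ≠ 0) (hp : 1 ≤ p) (hw : MemApStar p w) (hδ : 0 < δ)
    (hδK : δ ≤ Real.exp (-(256 * n * (apRec p w).toReal))) {κ : Type*} [Finite κ]
    (R : κ → BoxIntegral.Box (Fin n)) (S : Finset κ)
    (hS : ∀ j, volume.real (rectangle (R j) \ ⋃ k ∈ S, rectangle (R k)) <
      δ * volume.real (rectangle (R j))) :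
    weightOf w (⋃ j, rectangle (R j)) ≤
      (1 + 37 ^ n * δ ^ (1 / (256 * n * (apRec p w).toReal))) *
        weightOf w (⋃ k ∈ S, rectangle (R k)) := by
  have hbox (j : κ) : (R j : Set (Fin n → ℝ)) =ᵐ[volume] rectangle (R j) := (R j).coe_ae_eq_Icc
  have hunion : ⋃ k ∈ S, (R k : Set (Fin n → ℝ)) =ᵐ[volume] ⋃ k ∈ S, rectangle (R k) :=
    .countable_bUnion S.countable_toSet fun k _ => hbox k
  have hweight {E F : Set (Fin n → ℝ)} (hEF : E =ᵐ[volume] F) :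
      weightOf w F = (powMeasure w 1).real E :=
    (setIntegral_congr_set hEF.symm).trans (hw.1.weightOf_eq E)
  rw [hweight (.countable_iUnion hbox), hweight hunion]
  by_cases hzero : ∀ j, (powMeasure w 1).real (R j) = 0
  · rw [measureReal_def, measure_iUnion_null fun j => ?_, ENNReal.toReal_zero]
    · positivity
    · exact (measureReal_eq_zero_iff (hw.sqrtComparable hp |>.ne_top _)).1 (hzero j)
  · push Not at hzero
    obtain ⟨j, hj⟩ := hzero
    have hv : 0 < volume.real (R j : Set (Fin n → ℝ)) :=
      (measureReal_congr (hbox j)).symm ▸ volume_real_rectangle_pos (R j)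
    have hK := (hw.sqrtComparable hp).one_le (mul_pos hv (measureReal_nonneg.lt_of_ne' hj))
    refine hw.measureReal_iUnion_box_le hn hp hK hδ hδK R S fun j => ?_
    rw [measureReal_congr ((hbox j).diff hunion), measureReal_congr (hbox j)]
    exact hS j

end Solyanik

section Selection

variable {n : ℕ}

/-- The part of `R j` not covered by the earlier rectangles with index in `S`. -/
def newPart {κ : Type*} [LT κ] (R : κ → BoxIntegral.Box (Fin n)) (S : Finset κ) (j : κ) :
    Set (Fin n → ℝ) :=
  rectangle (R j) \ ⋃ i ∈ {i | i ∈ S ∧ i < j}, rectangle (R i)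

theorem newPart_subset {κ : Type*} [LT κ] (R : κ → BoxIntegral.Box (Fin n)) (S : Finset κ)
    (j : κ) : newPart R S j ⊆ rectangle (R j) :=
  Set.sdiff_subset

theorem measurableSet_biUnion_rectangle {κ : Type*} (R : κ → BoxIntegral.Box (Fin n)) {S : Set κ}
    (hS : S.Countable) : MeasurableSet (⋃ i ∈ S, rectangle (R i)) :=
  .biUnion hS fun i _ => measurableSet_rectangle (R i)

theorem measurableSet_newPart {κ : Type*} [LT κ] (R : κ → BoxIntegral.Box (Fin n)) (S : Finset κ)
    (j : κ) : MeasurableSet (newPart R S j) :=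
  (measurableSet_rectangle _).diff
    (measurableSet_biUnion_rectangle R (S.countable_toSet.mono fun _ hi => hi.1))

theorem pairwiseDisjoint_newPart {κ : Type*} [LinearOrder κ] (R : κ → BoxIntegral.Box (Fin n))
    (S : Finset κ) : (S : Set κ).PairwiseDisjoint (newPart R S) := by
  have hlt {i j : κ} (hi : i ∈ S) (hij : i < j) : Disjoint (newPart R S i) (newPart R S j) :=
    Set.disjoint_left.2 fun x hxi hxj =>
      hxj.2 (Set.mem_biUnion (show i ∈ {i | i ∈ S ∧ i < j} from ⟨hi, hij⟩) hxi.1)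
  intro i hi j hj hij
  rcases lt_or_gt_of_ne hij with h | h
  · exact hlt hi h
  · exact (hlt hj h).symm

theorem MemApStar.sum_weightOf_le {p δ : ℝ} {w : (Fin n → ℝ) → ℝ} (hp : 1 ≤ p)
    (hw : MemApStar p w) (hδ : 0 < δ) {κ : Type*} [LinearOrder κ]
    (R : κ → BoxIntegral.Box (Fin n)) (S : Finset κ)
    (hS : ∀ j ∈ S, δ * volume.real (rectangle (R j)) ≤ volume.real (newPart R S j)) :
    ∑ k ∈ S, weightOf w (rectangle (R k)) ≤
      (apRec p w).toReal / δ ^ p * weightOf w (⋃ k ∈ S, rectangle (R k)) := by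
  have hω {E F : Set (Fin n → ℝ)} (hF : IsCompact F) (hEF : E ⊆ F) : powMeasure w 1 E ≠ ∞ :=
    hw.1.powMeasure_ne_top zero_le_one le_rfl hF hEF
  calc ∑ k ∈ S, weightOf w (rectangle (R k))
      ≤ ∑ k ∈ S, (apRec p w).toReal / δ ^ p * weightOf w (newPart R S k) :=
        Finset.sum_le_sum fun k hk =>
          hw.weightOf_rectangle_le hp (R k) (newPart_subset R S k) hδ (hS k hk)
    _ = (apRec p w).toReal / δ ^ p * weightOf w (⋃ k ∈ S, newPart R S k) := by
        simp only [hw.1.weightOf_eq]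
        rw [← Finset.mul_sum, measureReal_biUnion_finset (pairwiseDisjoint_newPart R S)
          (fun k _ => measurableSet_newPart R S k)
          fun k _ => hω (isCompact_rectangle _) (newPart_subset R S k)]
    _ ≤ _ := by
        rw [hw.1.weightOf_eq, hw.1.weightOf_eq]
        gcongr with k
        · exact hω (S.isCompact_biUnion fun k _ => isCompact_rectangle (R k)) subset_rfl
        · exact newPart_subset R S k

variable {N : ℕ} {δ : ℝ} {R : Fin N → BoxIntegral.Box (Fin n)} {S : Finset (Fin N)}

theorem exists_isCordobaFeffermanSelection (δ : ℝ) (R : Fin N → BoxIntegral.Box (Fin n)) :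
    ∃ S : Finset (Fin N), IsCordobaFeffermanSelection δ R S := by
  classical
  let step (j : Fin N) (selected : (i : Fin N) → i < j → Prop) : Prop :=
    volume (rectangle (R j) ∩ ⋃ i ∈ {i | ∃ h : i < j, selected i h}, rectangle (R i)) ≤
      ENNReal.ofReal (1 - δ) * volume (rectangle (R j))
  let selected : Fin N → Prop := (wellFounded_lt (α := Fin N)).fix step
  refine ⟨Finset.univ.filter selected, fun j => ?_⟩
  have hselected : selected j = step j fun i _ => selected i := WellFounded.fix_eq _ _ _
  have hearlier : {i | i ∈ Finset.univ.filter selected ∧ i < j} =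
      {i | ∃ _ : i < j, selected i} := by
    ext i
    simp [and_comm]
  rw [hearlier, Finset.mem_filter, hselected]
  exact and_iff_right (Finset.mem_univ j)

theorem IsCordobaFeffermanSelection.mem_iff_le_volume_newPart
    (h : IsCordobaFeffermanSelection δ R S) (hδ : δ ≤ 1) (j : Fin N) :
    j ∈ S ↔ δ * volume.real (rectangle (R j)) ≤ volume.real (newPart R S j) := by
  have hv := volume_rectangle_ne_top (R j)
  have hsplit := measureReal_inter_add_sdiff (μ := volume) (s := rectangle (R j))
    (measurableSet_biUnion_rectangle R {i | i ∈ S ∧ i < j}.to_countable) hv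
  rw [h j, ← ENNReal.toReal_le_toReal (measure_ne_top_of_subset Set.inter_subset_left hv)
    (ENNReal.mul_ne_top ENNReal.ofReal_ne_top hv), ENNReal.toReal_mul,
    ENNReal.toReal_ofReal (sub_nonneg.2 hδ), ← measureReal_def, ← measureReal_def, newPart]
  constructor <;> intro <;> linarith

theorem IsCordobaFeffermanSelection.volume_real_sdiff_lt (h : IsCordobaFeffermanSelection δ R S)
    (hδ0 : 0 < δ) (hδ1 : δ ≤ 1) (j : Fin N) :
    volume.real (rectangle (R j) \ ⋃ k ∈ S, rectangle (R k)) <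
      δ * volume.real (rectangle (R j)) := by
  by_cases hj : j ∈ S
  · have hcovered : rectangle (R j) ⊆ ⋃ k ∈ S, rectangle (R k) :=
      Set.subset_iUnion₂_of_subset j hj subset_rfl
    rw [Set.sdiff_eq_empty.2 hcovered, measureReal_empty]
    exact mul_pos hδ0 (volume_real_rectangle_pos _)
  · have hnew : volume.real (newPart R S j) < δ * volume.real (rectangle (R j)) :=
      lt_of_not_ge fun hle => hj ((h.mem_iff_le_volume_newPart hδ1 j).2 hle)
    refine (measureReal_mono (Set.sdiff_subset_sdiff_right ?_)
      (measure_ne_top_of_subset (newPart_subset R S j) (volume_rectangle_ne_top _))).trans_lt hnew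
    exact Set.biUnion_subset_biUnion_left fun i hi => hi.1

end Selection

theorem mainTheorem5 :
    ∃ c : ℝ, 0 < c ∧ ∀ n : ℕ, 1 ≤ n → ∃ cn : ℝ, 0 < cn ∧
      ∀ (p : ℝ), 1 ≤ p → ∀ (w : (Fin n → ℝ) → ℝ), MemApStar p w →
      ∀ (δ : ℝ), 0 < δ → δ < Real.exp (-(c * n * (apRec p w).toReal)) →
      ∀ (N : ℕ) (R : Fin N → BoxIntegral.Box (Fin n)),
      ∃ S : Finset (Fin N), IsCordobaFeffermanSelection δ R S ∧
        weightOf w (⋃ j, rectangle (R j)) ≤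
          (1 + cn * δ ^ (1 / (c * n * (apRec p w).toReal))) *
            weightOf w (⋃ k ∈ S, rectangle (R k)) ∧
        ∑ k ∈ S, weightOf w (rectangle (R k)) ≤
          (apRec p w).toReal / δ ^ p * weightOf w (⋃ k ∈ S, rectangle (R k)) := by
  refine ⟨256, by norm_num, fun n hn => ⟨37 ^ n, by positivity, fun p hp w hw δ hδ hδK N R => ?_⟩⟩
  obtain ⟨S, hS⟩ := exists_isCordobaFeffermanSelection δ R
  have hδ1 : δ ≤ 1 := hδK.le.trans (Real.exp_le_one_iff.2 (neg_nonpos.2 (by positivity)))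
  exact ⟨S, hS,
    hw.weightOf_iUnion_le (Nat.one_le_iff_ne_zero.1 hn) hp hδ hδK.le R S
      (hS.volume_real_sdiff_lt hδ hδ1),
    hw.sum_weightOf_le hp hδ R S fun j hj => (hS.mem_iff_le_volume_newPart hδ1 j).1 hj⟩
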